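/- A set $V$ of points in $\mathbb{R}^d$ is called almost equidistant if among any three distinct points of $V$ some two are at distance $1$. Let $f(d)$ be the largest number of points in an almost-equidistant set in $\mathbb{R}^d$. A biaugmented tetrahedron with simple vertices $a,b$ consists of a regular tetrahedron $x_0x_1x_2x_3$ of edge length $1$ in $\mathbb{R}^3$ and two further such tetrahedra glued to it along faces: one with apex $a\ne x_0$ on the face $x_1x_2x_3$, and one with apex $b\neq x_1$ on the face $x_0x_2x_3$. Theorem. $f(3)=10$. Moreover, up to congruence, there is exactly one almost-equidistant set in $\mathbb{R}^3$ with $10$ points, namely the vertex set $\{a,b,x_0,x_1,x_2,x_3,y_0,y_1,y_2,y_3\}$ of two biaugmented tetrahedra with the same simple vertices $a,b$, and central tetrahedra $x_0x_1x_2x_3$ and $y_0y_1y_2y_3$ respectively (labelled in the same way), placed so that $\|x_0-y_0\|=\|x_1-y_1\|=1$. -/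

import Mathlib

/-- A set `V` of points in `ℝ^d` is almost equidistant if among any three (distinct) points of `V`
some two are at distance `1`. -/
def AlmostEquidistant {d : ℕ} (V : Set (EuclideanSpace ℝ (Fin d))) : Prop :=
  ∀ p ∈ V, ∀ q ∈ V, ∀ r ∈ V, p ≠ q → p ≠ r → q ≠ r →
    dist p q = 1 ∨ dist p r = 1 ∨ dist q r = 1

/-- The largest size `f(d)` of an almost-equidistant set in `ℝ^d`. The supremum is taken in `ℕ∞`
over all almost-equidistant sets, finite or not, so that a finite value is always attained. -/
noncomputable def maxAlmostEquidistant (d : ℕ) : ℕ∞ :=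
  sSup {n : ℕ∞ | ∃ V : Set (EuclideanSpace ℝ (Fin d)), AlmostEquidistant V ∧ V.encard = n}

/-- Two sets of points in `ℝ^d` are congruent if an isometry of `ℝ^d` maps one onto the other. -/
def CongruentSets {d : ℕ} (V W : Set (EuclideanSpace ℝ (Fin d))) : Prop :=
  ∃ e : EuclideanSpace ℝ (Fin d) ≃ᵢ EuclideanSpace ℝ (Fin d), e '' V = W

/-- The points `a, b, x 0, x 1, x 2, x 3` are the vertices of a biaugmented tetrahedron with simple
vertices `a` and `b`: a unit tetrahedron with vertices `x 0, x 1, x 2, x 3`, with one further unit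
tetrahedron, of apex `a`, glued to the facet opposite to `x 0`, and another one, of apex `b`, glued
to the facet opposite to `x 1`. -/
structure IsBiaugmentedTetrahedron (a b : EuclideanSpace ℝ (Fin 3))
    (x : Fin 4 → EuclideanSpace ℝ (Fin 3)) : Prop where
  dist_eq : ∀ i j, i ≠ j → dist (x i) (x j) = 1
  dist_left : ∀ i, i ≠ 0 → dist a (x i) = 1
  left_ne : a ≠ x 0
  dist_right : ∀ i, i ≠ 1 → dist b (x i) = 1
  right_ne : b ≠ x 1

/-- `V` is the vertex set of two biaugmented tetrahedra with the same two simple vertices, placed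
in such a way that the two vertices opposite to `a` are at unit distance, and so are the two
vertices opposite to `b`. -/
def IsPairOfBiaugmentedTetrahedra (V : Set (EuclideanSpace ℝ (Fin 3))) : Prop :=
  ∃ (a b : EuclideanSpace ℝ (Fin 3)) (x y : Fin 4 → EuclideanSpace ℝ (Fin 3)),
    IsBiaugmentedTetrahedron a b x ∧ IsBiaugmentedTetrahedron a b y ∧
    dist (x 0) (y 0) = 1 ∧ dist (x 1) (y 1) = 1 ∧
    V = {a, b} ∪ Set.range x ∪ Set.range y

/-!
Call two points close if they are at distance `1`. Among any three points of an almost-equidistant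
set two are close. In `ℝ³` there are no five pairwise close points (`not_five_unit`), and no two
triples of points such that each point of one is close to each point of the other
(`not_three_three_unit`, because the planes spanned by the two triples would be orthogonal). By
Ramsey's theorem at least ten points with the first property contain four pairwise close ones
(`exists_pairwise_four`).

The graphs on ten or eleven vertices that satisfy these combinatorial conditions are searched
exhaustively, by adding vertices one at a time to a four-clique. Every graph on ten vertices that
the search finds contains one of four graphs, and every one on eleven vertices contains the first
of the four.

* Two chains of three tetrahedra that share an edge, with the last vertex of one chain close to the
  last two vertices of the other one. The chains are rigid up to one angle, so that the two
  distances at issue are affine functions of one cosine; they are never both `1`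
  (`not_two_chains`).
* A closed ring of five tetrahedra, any two consecutive ones sharing an edge. The shared edges are
  five unit segments, and the squared distances of their midpoints satisfy a cyclic system of
  equations without solutions (`not_ring_of_five_tetrahedra`).
* The graph of the pairs from a five-element set, two of them joined if they meet. The pairs from
  four of the elements form an octahedron, whose diagonals share their midpoint. Hence the graph
  contains two triangles that are translates of one another by a unit vector, and no point is close
  to all their vertices (`not_unit_to_prism`).
* The pair of biaugmented tetrahedra of the theorem.

So an almost-equidistant set has at most ten points, and with ten points it is a pair of biaugmented
tetrahedra. In a frame built from the common simple vertices and the centres of the edges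
`x 0`, `x 1` and `y 0`, `y 1`, all ten points are determined up to the exchange of `x 2` with `x 3`
and of `y 2` with `y 3`, and they are the points `extremalPoint i`, whose distances are computed
directly.

The search is run by the kernel, so its definitions are shaped for fast reduction there. A graph is
a single natural number, on which the kernel computes with big integers; recursions are direct uses
of `Nat.rec`; operations are the raw functions `Nat.land`, `Nat.lor` and so on, which avoids
unfolding instances; and `force` makes evaluation strict where a value is used repeatedly.
-/

open Module

local notation "E3" => EuclideanSpace ℝ (Fin 3)

/-! ### Unit distances in three-dimensional space -/

theorem inner_eq_coord (u v : E3) : inner ℝ u v = u 0 * v 0 + u 1 * v 1 + u 2 * v 2 := by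
  simp [PiLp.inner_apply, Fin.sum_univ_three, mul_comm]

theorem dist_eq_one_iff (p q : E3) :
    dist p q = 1 ↔ (p 0 - q 0) ^ 2 + (p 1 - q 1) ^ 2 + (p 2 - q 2) ^ 2 = 1 := by
  rw [EuclideanSpace.dist_eq, Real.sqrt_eq_one, Fin.sum_univ_three]
  simp [Real.dist_eq, sq_abs]

/-- The vectors orthogonal to two independent vectors of `ℝ³` form a line. -/
theorem exists_smul_eq_of_orthogonal {u v d e : E3} (huv : LinearIndependent ℝ ![u, v])
    (hd : d ≠ 0) (hud : inner ℝ u d = 0) (hvd : inner ℝ v d = 0) (hue : inner ℝ u e = 0)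
    (hve : inner ℝ v e = 0) : ∃ c : ℝ, e = c • d := by
  set K : Submodule ℝ E3 := Submodule.span ℝ (Set.range ![u, v])
  have hK : finrank ℝ K = 2 := by simpa using finrank_span_eq_card huv
  have hK' : finrank ℝ Kᗮ = 1 := by
    have := K.finrank_add_finrank_orthogonal
    rw [hK, finrank_euclideanSpace_fin] at this
    omega
  have mem : ∀ w : E3, inner ℝ u w = 0 → inner ℝ v w = 0 → w ∈ Kᗮ := by
    intro w hu hv
    rw [Submodule.mem_orthogonal]
    intro x hx
    induction hx using Submodule.span_induction with
    | mem x hx => obtain ⟨i, rfl⟩ := hx; fin_cases i <;> assumption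
    | zero => simp
    | add x y _ _ hx hy => rw [inner_add_left, hx, hy, add_zero]
    | smul c x _ hx => rw [inner_smul_left, hx, mul_zero]
  obtain ⟨c, hc⟩ := (finrank_eq_one_iff_of_nonzero' (⟨d, mem d hud hvd⟩ : Kᗮ)
    (by simpa [Subtype.ext_iff] using hd)).1 hK' ⟨e, mem e hue hve⟩
  exact ⟨c, by simpa using (congrArg Subtype.val hc).symm⟩

theorem linearIndependent_pair_of_gram {u v : E3}
    (h : inner ℝ u u * inner ℝ v v - inner ℝ u v ^ 2 ≠ (0 : ℝ)) :
    LinearIndependent ℝ ![u, v] := by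
  rw [LinearIndependent.pair_iff]
  intro s t hst
  have h1 : s * inner ℝ u u + t * inner ℝ u v = (0 : ℝ) := by
    have := congrArg (fun w => (inner ℝ u w : ℝ)) hst
    simpa [inner_add_right, inner_smul_right] using this
  have h2 : s * inner ℝ u v + t * inner ℝ v v = (0 : ℝ) := by
    have := congrArg (fun w => (inner ℝ v w : ℝ)) hst
    simpa [inner_add_right, inner_smul_right, real_inner_comm] using this
  constructor
  · refine (mul_eq_zero.1
      (?_ : s * (inner ℝ u u * inner ℝ v v - inner ℝ u v ^ 2) = 0)).resolve_right h
    linear_combination inner ℝ v v * h1 - inner ℝ u v * h2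
  · refine (mul_eq_zero.1
      (?_ : t * (inner ℝ u u * inner ℝ v v - inner ℝ u v ^ 2) = 0)).resolve_right h
    linear_combination inner ℝ u u * h2 - inner ℝ u v * h1

/-- A vector of `ℝ³` vanishes as soon as it is orthogonal to two independent vectors and to a
non-zero vector that is itself orthogonal to these two. This is how identities between points are
proved from distances here: each of the three scalar products is a linear combination of squared
distances. -/
theorem eq_zero_of_orthogonal {u v d e : E3} (huv : LinearIndependent ℝ ![u, v])
    (hd : d ≠ 0) (hud : inner ℝ u d = 0) (hvd : inner ℝ v d = 0) (hue : inner ℝ u e = 0)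
    (hve : inner ℝ v e = 0) (hde : inner ℝ d e = 0) : e = 0 := by
  obtain ⟨c, rfl⟩ := exists_smul_eq_of_orthogonal huv hd hud hvd hue hve
  rw [inner_smul_right, mul_eq_zero, inner_self_eq_zero] at hde
  rw [hde.resolve_right hd, zero_smul]

theorem linearIndependent_pair_of_orthogonal {u v : E3} (hu : u ≠ 0) (hv : v ≠ 0)
    (h : inner ℝ u v = 0) : LinearIndependent ℝ ![u, v] := by
  apply linearIndependent_pair_of_gram
  rw [h]
  simp [hu, hv]

theorem linearIndependent_sub_of_unit_triangle {x y z : E3} (hxy : dist x y = 1)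
    (hxz : dist x z = 1) (hyz : dist y z = 1) : LinearIndependent ℝ ![y - x, z - x] := by
  rw [dist_eq_one_iff] at hxy hxz hyz
  have h1 : (inner ℝ (y - x) (y - x) : ℝ) = 1 := by
    rw [inner_eq_coord]; simp only [PiLp.sub_apply]; linear_combination hxy
  have h2 : (inner ℝ (z - x) (z - x) : ℝ) = 1 := by
    rw [inner_eq_coord]; simp only [PiLp.sub_apply]; linear_combination hxz
  have h3 : (inner ℝ (y - x) (z - x) : ℝ) = 1 / 2 := by
    rw [inner_eq_coord]; simp only [PiLp.sub_apply]
    linear_combination (hxy + hxz - hyz) / 2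
  apply linearIndependent_pair_of_gram
  rw [h1, h2, h3]; norm_num

/-- The two apexes of unit tetrahedra on a common face are mirror images in the plane of that face:
their midpoint is the centroid of the face. -/
theorem add_eq_of_unit_tetrahedra {p q x y z : E3} (hpq : p ≠ q) (hxy : dist x y = 1)
    (hxz : dist x z = 1) (hyz : dist y z = 1) (hpx : dist p x = 1)
    (hpy : dist p y = 1) (hpz : dist p z = 1) (hqx : dist q x = 1) (hqy : dist q y = 1)
    (hqz : dist q z = 1) (i : Fin 3) : p i = 2 / 3 * (x i + y i + z i) - q i := by
  have hne : p - q ≠ 0 := sub_ne_zero.2 hpq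
  have hli := linearIndependent_sub_of_unit_triangle hxy hxz hyz
  rw [dist_eq_one_iff] at *
  have key : p + q - (2 / 3 : ℝ) • (x + y + z) = 0 := by
    apply eq_zero_of_orthogonal hli hne <;> rw [inner_eq_coord] <;>
      simp only [PiLp.sub_apply, PiLp.add_apply, PiLp.smul_apply, smul_eq_mul]
    · linear_combination (hqy - hqx - hpy + hpx) / 2
    · linear_combination (hqz - hqx - hpz + hpx) / 2
    · linear_combination (hpx - hpy + hqx - hqy) / 2 + (hyz - hxz) / 3
    · linear_combination (hpx - hpz + hqx - hqz) / 2 + (hyz - hxy) / 3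
    · linear_combination (hpx + hpy + hpz - hqx - hqy - hqz) / 3
  have k : p i + q i - 2 / 3 * (x i + y i + z i) = 0 := by
    simpa [mul_add] using congrArg (fun w : E3 => w i) key
  linear_combination k

theorem not_five_unit {p q x y z : E3} (hpq : dist p q = 1) (hpx : dist p x = 1)
    (hpy : dist p y = 1) (hpz : dist p z = 1) (hqx : dist q x = 1) (hqy : dist q y = 1)
    (hqz : dist q z = 1) (hxy : dist x y = 1) (hxz : dist x z = 1) (hyz : dist y z = 1) :
    False := by
  have k := add_eq_of_unit_tetrahedra (by rintro rfl; simp at hpq) hxy hxz hyz hpx hpy hpz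
    hqx hqy hqz
  rw [dist_eq_one_iff] at *
  -- Subtract from `k` the scalar product with `p - x`, computed from the distances.
  have : (5 : ℝ) / 2 = 0 := by
    linear_combination
      3 * ((p 0 - x 0) * k 0 + (p 1 - x 1) * k 1 + (p 2 - x 2) * k 2) - 3 * hpx
        - 3 / 2 * (hpx + hqx - hpq) + (hpx + hxy - hpy) + (hpx + hxz - hpz)
  norm_num at this

/-- Three distinct points on a sphere are not collinear. -/
theorem linearIndependent_sub_of_common_neighbour {a b c o : E3} (hab : a ≠ b) (hac : a ≠ c)
    (hbc : b ≠ c) (ha : dist a o = 1) (hb : dist b o = 1) (hc : dist c o = 1) :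
    LinearIndependent ℝ ![b - a, c - a] := by
  have hcos : EuclideanGeometry.Cospherical ({a, b, c} : Set E3) :=
    ⟨o, 1, by simp [ha, hb, hc]⟩
  have h := hcos.affineIndependent_of_ne hab hac hbc
  rw [affineIndependent_iff_linearIndependent_vsub ℝ _ (0 : Fin 3)] at h
  have h' := h.comp (fun i : Fin 2 => (⟨i.succ, Fin.succ_ne_zero i⟩ : {x : Fin 3 // x ≠ 0}))
    (fun i j hij => by simpa using hij)
  have e : ![b - a, c - a] = (fun i : {x : Fin 3 // x ≠ 0} => ![a, b, c] i -ᵥ ![a, b, c] 0) ∘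
      fun i : Fin 2 => ⟨i.succ, Fin.succ_ne_zero i⟩ := by
    funext i; fin_cases i <;> rfl
  rw [e]
  exact h'

/-- The unit graph of `ℝ³` contains no complete bipartite graph `K₃,₃`: the points of one triple
would lie on a normal of the plane of the other one, but they are not collinear. -/
theorem not_three_three_unit {a b c x y z : E3} (hab : a ≠ b) (hac : a ≠ c) (hbc : b ≠ c)
    (hxy : x ≠ y) (hxz : x ≠ z) (hyz : y ≠ z) (hax : dist a x = 1) (hay : dist a y = 1)
    (haz : dist a z = 1) (hbx : dist b x = 1) (hby : dist b y = 1) (hbz : dist b z = 1)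
    (hcx : dist c x = 1) (hcy : dist c y = 1) (hcz : dist c z = 1) : False := by
  have h1 := linearIndependent_sub_of_common_neighbour hab hac hbc hax hbx hcx
  have h2 := linearIndependent_sub_of_common_neighbour hxy hxz hyz (dist_comm a x ▸ hax)
    (dist_comm a y ▸ hay) (dist_comm a z ▸ haz)
  rw [dist_eq_one_iff] at *
  obtain ⟨t, ht⟩ : ∃ t : ℝ, z - x = t • (y - x) := by
    apply exists_smul_eq_of_orthogonal h1 (sub_ne_zero.2 hxy.symm) <;> rw [inner_eq_coord] <;>
      simp only [PiLp.sub_apply]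
    · linear_combination (hbx - hby - hax + hay) / 2
    · linear_combination (hcx - hcy - hax + hay) / 2
    · linear_combination (hbx - hbz - hax + haz) / 2
    · linear_combination (hcx - hcz - hax + haz) / 2
  rw [LinearIndependent.pair_iff] at h2
  have := (h2 t (-1) (by rw [ht]; simp)).2
  norm_num at this

/-! ### Graphs that are not unit-distance graphs -/

/-- The tetrahedra `a b p q`, `c a p q`, `d c p q` form a chain around the edge `p q`, and the
tetrahedra `a b r s`, `e b r s`, `f e r s` form one around the edge `r s`. The last vertex `f` of
the second chain cannot be at unit distance from both `c` and `d`. -/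
theorem not_two_chains {p q r s a b c d e f : E3} (hpq : dist p q = 1) (hap : dist a p = 1)
    (haq : dist a q = 1) (hbp : dist b p = 1) (hbq : dist b q = 1) (hab : dist a b = 1)
    (hcp : dist c p = 1) (hcq : dist c q = 1) (hca : dist c a = 1) (hcb : c ≠ b)
    (hdp : dist d p = 1) (hdq : dist d q = 1) (hdc : dist d c = 1) (hda : d ≠ a)
    (hrs : dist r s = 1) (har : dist a r = 1) (has : dist a s = 1) (hbr : dist b r = 1)
    (hbs : dist b s = 1) (her : dist e r = 1) (hes : dist e s = 1) (heb : dist e b = 1)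
    (hea : e ≠ a) (hfr : dist f r = 1) (hfs : dist f s = 1) (hfe : dist f e = 1) (hfb : f ≠ b)
    (hfc : dist f c = 1) (hfd : dist f d = 1) : False := by
  have kc := add_eq_of_unit_tetrahedra hcb hap haq hpq hca hcp hcq (dist_comm a b ▸ hab) hbp hbq
  have kd := add_eq_of_unit_tetrahedra hda hcp hcq hpq hdc hdp hdq (dist_comm c a ▸ hca) hap haq
  have ke := add_eq_of_unit_tetrahedra hea hbr hbs hrs heb her hes hab har has
  have kf := add_eq_of_unit_tetrahedra hfb her hes hrs hfe hfr hfs (dist_comm e b ▸ heb) hbr hbs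
  rw [dist_eq_one_iff] at hfc hfd hpq hap haq hbp hbq hab hrs har has hbr hbs
  simp only [kf, ke, kd, kc] at hfc hfd
  -- Both distances are affine functions of `⟪p + q - a - b, r + s - a - b⟫`, which this
  -- combination eliminates.
  have : (-35 : ℝ) / 9 = 0 := by
    linear_combination 3 * hfd - 5 * hfc + 79 / 27 * hab - 110 / 27 * (hap + haq)
      + 190 / 27 * (har + has) + 10 / 9 * (hbp + hbq) - 170 / 81 * (hbr + hbs) + 40 / 27 * hpq
      - 200 / 81 * hrs
  norm_num at this

/-- The diagonals `a a'` and `b b'` of a regular octahedron have the same midpoint. -/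
theorem add_eq_add_of_octahedron {a a' b b' c c' : E3} (ha : a ≠ a') (hb : b ≠ b') (hc : c ≠ c')
    (hab : dist a b = 1) (hab' : dist a b' = 1) (ha'b : dist a' b = 1) (ha'b' : dist a' b' = 1)
    (hac : dist a c = 1) (hac' : dist a c' = 1) (ha'c : dist a' c = 1) (ha'c' : dist a' c' = 1)
    (hbc : dist b c = 1) (hbc' : dist b c' = 1) (hb'c : dist b' c = 1) (hb'c' : dist b' c' = 1) :
    a + a' = b + b' := by
  rw [dist_eq_one_iff] at *
  rw [← sub_eq_zero]
  have h : (inner ℝ (a - a') (b - b') : ℝ) = 0 := by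
    rw [inner_eq_coord]; simp only [PiLp.sub_apply]
    linear_combination (hab' + ha'b - hab - ha'b') / 2
  apply eq_zero_of_orthogonal
    (linearIndependent_pair_of_orthogonal (sub_ne_zero.2 ha) (sub_ne_zero.2 hb) h)
    (sub_ne_zero.2 hc) <;> rw [inner_eq_coord] <;> simp only [PiLp.sub_apply, PiLp.add_apply]
  · linear_combination (hac' + ha'c - hac - ha'c') / 2
  · linear_combination (hbc' + hb'c - hbc - hb'c') / 2
  · linear_combination (hab + hab' - ha'b - ha'b') / 2
  · linear_combination (hab' + ha'b' - hab - ha'b) / 2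
  · linear_combination (hac' - hac + ha'c' - ha'c + hbc - hbc' + hb'c - hb'c') / 2

/-- No point is at unit distance from the six vertices of a unit triangle `x y z` and of its
translate `x' y' z'` by a unit vector. Being equally far from corresponding vertices, it forces the
translation vector to be normal to the triangle, and to have the squared length `3 / 8`. -/
theorem not_unit_to_prism {o x y z x' y' z' : E3} (hxy : dist x y = 1) (hxz : dist x z = 1)
    (hyz : dist y z = 1) (hxx' : dist x x' = 1) (hy' : x' - x = y' - y) (hz' : x' - x = z' - z)
    (hox : dist o x = 1) (hoy : dist o y = 1) (hoz : dist o z = 1) (hox' : dist o x' = 1)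
    (hoy' : dist o y' = 1) (hoz' : dist o z' = 1) : False := by
  have hli := linearIndependent_sub_of_unit_triangle hxy hxz hyz
  rw [dist_eq_one_iff] at *
  have ky : ∀ i, y' i = y i + (x' i - x i) := fun i => by
    have := congrArg (fun w : E3 => w i) hy'
    simp only [PiLp.sub_apply] at this
    linear_combination -this
  have kz : ∀ i, z' i = z i + (x' i - x i) := fun i => by
    have := congrArg (fun w : E3 => w i) hz'
    simp only [PiLp.sub_apply] at this
    linear_combination -this
  simp only [ky, kz] at hoy' hoz'
  have hd : o - (1 / 3 : ℝ) • (x + y + z) ≠ 0 := by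
    intro h
    have k : ∀ i, o i - 1 / 3 * (x i + y i + z i) = 0 := fun i => by
      simpa [mul_add] using congrArg (fun w : E3 => w i) h
    have : (2 : ℝ) / 3 = 0 := by
      linear_combination (o 0 - x 0) * k 0 + (o 1 - x 1) * k 1 + (o 2 - x 2) * k 2 - hox
        + (hox + hxy - hoy) / 6 + (hox + hxz - hoz) / 6
    norm_num at this
  have key : x' - x - (3 / 4 : ℝ) • (o - (1 / 3 : ℝ) • (x + y + z)) = 0 := by
    apply eq_zero_of_orthogonal hli hd <;> rw [inner_eq_coord] <;>
      simp only [PiLp.sub_apply, PiLp.add_apply, PiLp.smul_apply, smul_eq_mul]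
    · linear_combination (hox - hoy) / 2 + (hyz - hxz) / 6
    · linear_combination (hox - hoz) / 2 + (hyz - hxy) / 6
    · linear_combination (hox + hxx' - hox') / 2 - (hoy + hxx' - hoy') / 2
        - 3 / 4 * ((hox - hoy) / 2 + (hyz - hxz) / 6)
    · linear_combination (hox + hxx' - hox') / 2 - (hoz + hxx' - hoz') / 2
        - 3 / 4 * ((hox - hoz) / 2 + (hyz - hxy) / 6)
    · linear_combination ((hox + hxx' - hox') + (hoy + hxx' - hoy') + (hoz + hxx' - hoz')) / 6
        - 3 / 4 * ((hox + hoy + hoz) / 3 - (hxy + hxz + hyz) / 9)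
  have k : ∀ i, x' i - x i - 3 / 4 * (o i - 1 / 3 * (x i + y i + z i)) = 0 := fun i => by
      simpa [mul_add, mul_sub] using congrArg (fun w : E3 => w i) key
  -- The translation vector is now too short.
  have : (1 : ℝ) - 3 / 8 = 0 := by
    linear_combination
      (x' 0 - x 0) * k 0 + (x' 1 - x 1) * k 1 + (x' 2 - x 2) * k 2 - hxx'
        + ((hox + hxx' - hox') + (hoy + hxx' - hoy') + (hoz + hxx' - hoz')) / 8
  norm_num at this

theorem midpoint_apply (p q : E3) (i : Fin 3) : midpoint ℝ p q i = (p i + q i) / 2 := by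
  simp [midpoint_eq_smul_add]; ring

/-- If `u`, `v`, `w` are orthogonal with `⟪w, w⟫ = 1 / 2`, and `w₁ ⊥ u`, `w₃ ⊥ v`, then the scalar
product of `w₁` and `w₃` comes from their components along `w` alone. -/
theorem inner_eq_of_orthogonal_planes {u v w w₁ w₃ : E3} (hu : u ≠ 0) (hv : v ≠ 0)
    (hw : inner ℝ w w = (1 / 2 : ℝ)) (huv : inner ℝ u v = (0 : ℝ)) (huw : inner ℝ u w = (0 : ℝ))
    (hvw : inner ℝ v w = (0 : ℝ)) (hu₁ : inner ℝ u w₁ = (0 : ℝ)) (hv₃ : inner ℝ v w₃ = (0 : ℝ)) :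
    (inner ℝ w₁ w₃ : ℝ) = 2 * inner ℝ w₁ w * inner ℝ w w₃ := by
  have hw0 : w ≠ 0 := by rintro rfl; simp at hw
  obtain ⟨c, hc⟩ := exists_smul_eq_of_orthogonal (e := w₁ - (2 * inner ℝ w w₁ : ℝ) • w)
    (linearIndependent_pair_of_orthogonal hu hw0 huw) hv huv
    ((real_inner_comm _ _).trans hvw) (by simp [inner_sub_right, inner_smul_right, hu₁, huw])
    (by simp only [inner_sub_right, inner_smul_right, hw]; ring)
  have h := congrArg (fun x => (inner ℝ x w₃ : ℝ)) hc
  simp only [inner_sub_left, real_inner_smul_left, hv₃] at h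
  rw [real_inner_comm w w₁]
  linear_combination h

/-- In a chain of three unit tetrahedra, consecutive ones meeting in opposite edges, the distance
of the midpoints of the first and last edge is determined by the two intermediate distances. -/
theorem sq_dist_midpoint_of_three_unit_tetrahedra {p₁ q₁ p₂ q₂ p₃ q₃ p₄ q₄ : E3}
    (h₁ : dist p₁ q₁ = 1) (h₂ : dist p₂ q₂ = 1) (h₃ : dist p₃ q₃ = 1) (h₄ : dist p₄ q₄ = 1)
    (h₁₂ : dist p₁ p₂ = 1 ∧ dist p₁ q₂ = 1 ∧ dist q₁ p₂ = 1 ∧ dist q₁ q₂ = 1)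
    (h₂₃ : dist p₂ p₃ = 1 ∧ dist p₂ q₃ = 1 ∧ dist q₂ p₃ = 1 ∧ dist q₂ q₃ = 1)
    (h₃₄ : dist p₃ p₄ = 1 ∧ dist p₃ q₄ = 1 ∧ dist q₃ p₄ = 1 ∧ dist q₃ q₄ = 1) :
    dist (midpoint ℝ p₁ q₁) (midpoint ℝ p₄ q₄) ^ 2 =
      1 / 2 + dist (midpoint ℝ p₁ q₁) (midpoint ℝ p₃ q₃) ^ 2 *
        dist (midpoint ℝ p₂ q₂) (midpoint ℝ p₄ q₄) ^ 2 := by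
  have hu : p₂ - q₂ ≠ 0 := by rw [sub_ne_zero]; rintro rfl; simp at h₂
  have hv : p₃ - q₃ ≠ 0 := by rw [sub_ne_zero]; rintro rfl; simp at h₃
  simp only [dist_eq_one_iff] at *
  obtain ⟨a1, a2, a3, a4⟩ := h₁₂
  obtain ⟨b1, b2, b3, b4⟩ := h₂₃
  obtain ⟨c1, c2, c3, c4⟩ := h₃₄
  obtain ⟨w₁, e₁⟩ : ∃ w, w = midpoint ℝ p₁ q₁ - midpoint ℝ p₂ q₂ := ⟨_, rfl⟩
  obtain ⟨w, e⟩ : ∃ w, w = midpoint ℝ p₂ q₂ - midpoint ℝ p₃ q₃ := ⟨_, rfl⟩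
  obtain ⟨w₃, e₃⟩ : ∃ w, w = midpoint ℝ p₃ q₃ - midpoint ℝ p₄ q₄ := ⟨_, rfl⟩
  have hw₁ : (inner ℝ w₁ w₁ : ℝ) = 1 / 2 := by
    rw [e₁, inner_eq_coord]; simp only [PiLp.sub_apply, midpoint_apply]
    linear_combination (a1 + a2 + a3 + a4 - h₁ - h₂) / 4
  have hw : (inner ℝ w w : ℝ) = 1 / 2 := by
    rw [e, inner_eq_coord]; simp only [PiLp.sub_apply, midpoint_apply]
    linear_combination (b1 + b2 + b3 + b4 - h₂ - h₃) / 4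
  have hw₃ : (inner ℝ w₃ w₃ : ℝ) = 1 / 2 := by
    rw [e₃, inner_eq_coord]; simp only [PiLp.sub_apply, midpoint_apply]
    linear_combination (c1 + c2 + c3 + c4 - h₃ - h₄) / 4
  have key : (inner ℝ w₁ w₃ : ℝ) = 2 * inner ℝ w₁ w * inner ℝ w w₃ := by
    apply inner_eq_of_orthogonal_planes hu hv hw <;> rw [inner_eq_coord] <;>
      simp only [e₁, e, e₃, PiLp.sub_apply, midpoint_apply]
    · linear_combination (b2 + b3 - b1 - b4) / 2
    · linear_combination (b1 + b2 - b3 - b4) / 4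
    · linear_combination (b2 + b4 - b1 - b3) / 4
    · linear_combination (a2 + a4 - a1 - a3) / 4
    · linear_combination (c1 + c2 - c3 - c4) / 4
  rw [dist_eq_norm, dist_eq_norm, dist_eq_norm,
    show midpoint ℝ p₁ q₁ - midpoint ℝ p₄ q₄ = w₁ + w + w₃ by rw [e₁, e, e₃]; abel,
    show midpoint ℝ p₁ q₁ - midpoint ℝ p₃ q₃ = w₁ + w by rw [e₁, e]; abel,
    show midpoint ℝ p₂ q₂ - midpoint ℝ p₄ q₄ = w + w₃ by rw [e, e₃]; abel,
    norm_add_sq_real (w₁ + w), norm_add_sq_real w₁, norm_add_sq_real w, inner_add_left,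
    ← real_inner_self_eq_norm_sq, ← real_inner_self_eq_norm_sq, ← real_inner_self_eq_norm_sq,
    hw₁, hw, hw₃]
  linear_combination 2 * key

/-- Five unit tetrahedra cannot be joined cyclically along opposite edges. -/
theorem not_ring_of_five_tetrahedra (p q : Fin 5 → E3) (h : ∀ i, dist (p i) (q i) = 1)
    (h' : ∀ i, dist (p i) (p (i + 1)) = 1 ∧ dist (p i) (q (i + 1)) = 1 ∧
      dist (q i) (p (i + 1)) = 1 ∧ dist (q i) (q (i + 1)) = 1) : False := by
  obtain ⟨t, ht⟩ : ∃ t : Fin 5 → ℝ, ∀ i, t i =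
    dist (midpoint ℝ (p i) (q i)) (midpoint ℝ (p (i + 2)) (q (i + 2))) ^ 2 := ⟨_, fun _ => rfl⟩
  have key : ∀ i, t (i + 3) = 1 / 2 + t i * t (i + 1) := by
    intro i
    have := sq_dist_midpoint_of_three_unit_tetrahedra (h i) (h (i + 1)) (h (i + 1 + 1))
      (h (i + 1 + 1 + 1)) (h' i) (h' (i + 1)) (h' (i + 1 + 1))
    rw [ht, ht, ht, dist_comm, show i + 3 + 2 = i by rw [add_assoc]; exact add_zero i]
    simpa only [add_assoc, show (1 : Fin 5) + 1 = 2 from rfl, show (1 : Fin 5) + 2 = 3 from rfl,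
      show (2 : Fin 5) + 1 = 3 from rfl]
      using this
  have pos : ∀ i, 0 ≤ t i := fun i => by rw [ht]; positivity
  -- The least of the five numbers would exceed its own square by at least `1 / 2`.
  obtain ⟨i, hi⟩ := Finite.exists_min t
  have e := key (i + 2)
  rw [show i + 2 + 3 = i by rw [add_assoc]; exact add_zero i] at e
  nlinarith [mul_le_mul (hi (i + 2)) (hi (i + 2 + 1)) (pos i) (pos (i + 2)),
    sq_nonneg (t i - 1 / 2)]

/-! ### The extremal configuration -/

/-- Coordinates of the extremal configuration, in the order `a, b, x 0, …, x 3, y 0, …, y 3`. The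
third axis is the line through the simple vertices `a` and `b`, the first one bisects the angle
between the two half-planes bounded by that line that hold `x 0`, `x 1` and `y 0`, `y 1`. -/
noncomputable def extremalPoint : Fin 10 → E3 :=
  ![!₂[0, 0, 5 / 6], !₂[0, 0, -5 / 6],
    !₂[√23 / 6, 1 / 2, -1 / 2], !₂[√23 / 6, 1 / 2, 1 / 2],
    !₂[√23 / 24 - 3 * √2 / 16, 1 / 8 + √23 * √2 / 16, 0],
    !₂[√23 / 24 + 3 * √2 / 16, 1 / 8 - √23 * √2 / 16, 0],
    !₂[√23 / 6, -1 / 2, -1 / 2], !₂[√23 / 6, -1 / 2, 1 / 2],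
    !₂[√23 / 24 - 3 * √2 / 16, -1 / 8 - √23 * √2 / 16, 0],
    !₂[√23 / 24 + 3 * √2 / 16, -1 / 8 + √23 * √2 / 16, 0]]

/-- The pairs of indices whose points in the extremal configuration are not claimed to be at unit
distance. -/
def IsFar (i j : Fin 10) : Bool :=
  [(0, 1), (0, 2), (0, 6), (1, 3), (1, 7), (2, 7), (2, 8), (2, 9), (3, 6), (3, 8), (3, 9),
    (4, 6), (4, 7), (4, 8), (4, 9), (5, 6), (5, 7), (5, 8), (5, 9)].contains (min i j, max i j)

theorem dist_extremalPoint {i j : Fin 10} (hij : i ≠ j) (h : IsFar i j = false) :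
    dist (extremalPoint i) (extremalPoint j) = 1 := by
  have key : ∀ i j, i < j → IsFar i j = false →
      dist (extremalPoint i) (extremalPoint j) = 1 := by
    clear hij h i j
    intro i j hij h
    have h2 : √2 ^ 2 = (2 : ℝ) := Real.sq_sqrt (by norm_num)
    have h23 : √23 ^ 2 = (23 : ℝ) := Real.sq_sqrt (by norm_num)
    rw [dist_eq_one_iff]
    fin_cases i <;> fin_cases j <;> first
      | exact absurd hij (by decide)
      | exact absurd h (by decide)
      | (simp [extremalPoint]
         try ring_nf
         try simp only [h2, h23]
         try norm_num)
  rcases lt_or_gt_of_ne hij with hij | hij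
  · exact key i j hij h
  · rw [dist_comm]
    exact key j i hij (by rwa [IsFar, min_comm, max_comm])

theorem extremalPoint_injective : Function.Injective extremalPoint := by
  have key : ∀ i j, i < j → IsFar i j = true → extremalPoint i ≠ extremalPoint j := by
    intro i j hij h heq
    have h1 := congrArg (fun w : E3 => w 1) heq
    have h2 := congrArg (fun w : E3 => w 2) heq
    have ht : 0 < √23 * √2 := by positivity
    have ht' : (√23 * √2) ^ 2 = (46 : ℝ) := by
      rw [mul_pow, Real.sq_sqrt (by norm_num), Real.sq_sqrt (by norm_num)]; norm_num
    clear heq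
    fin_cases i <;> fin_cases j <;> first
      | exact absurd hij (by decide)
      | exact absurd h (by decide)
      | (simp [extremalPoint] at h2; done)
      | (simp [extremalPoint] at h2; norm_num at h2; done)
      | (simp [extremalPoint] at h1; nlinarith)
  have ne : ∀ i j, i < j → extremalPoint i ≠ extremalPoint j := by
    intro i j hij
    cases h : IsFar i j
    · intro heq
      have := dist_extremalPoint hij.ne h
      rw [heq, dist_self] at this
      norm_num at this
    · exact key i j hij h
  intro i j h
  by_contra hij
  rcases lt_or_gt_of_ne hij with hij | hij
  · exact ne i j hij h
  · exact ne j i hij h.symm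

theorem almostEquidistant_extremal : AlmostEquidistant (Set.range extremalPoint) := by
  rintro _ ⟨i, rfl⟩ _ ⟨j, rfl⟩ _ ⟨k, rfl⟩ hij hik hjk
  have far_free : ∀ i j k : Fin 10, i ≠ j → i ≠ k → j ≠ k →
      IsFar i j = false ∨ IsFar i k = false ∨ IsFar j k = false := by decide +kernel
  have hij' : i ≠ j := fun h => hij (congrArg _ h)
  have hik' : i ≠ k := fun h => hik (congrArg _ h)
  have hjk' : j ≠ k := fun h => hjk (congrArg _ h)
  exact (far_free i j k hij' hik' hjk').imp (dist_extremalPoint hij')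
    (Or.imp (dist_extremalPoint hik') (dist_extremalPoint hjk'))

theorem encard_extremal : (Set.range extremalPoint).encard = 10 := by
  rw [← Set.image_univ, extremalPoint_injective.encard_image, Set.encard_univ]
  simp

theorem isPairOfBiaugmentedTetrahedra_extremal :
    IsPairOfBiaugmentedTetrahedra (Set.range extremalPoint) := by
  have aux : ∀ f : Fin 4 → Fin 10, (∀ i j, i ≠ j → f i ≠ f j ∧ IsFar (f i) (f j) = false) →
      (∀ i, 0 ≠ f i ∧ 1 ≠ f i) → (∀ i, i ≠ 0 → IsFar 0 (f i) = false) →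
      (∀ i, i ≠ 1 → IsFar 1 (f i) = false) →
      IsBiaugmentedTetrahedron (extremalPoint 0) (extremalPoint 1) (extremalPoint ∘ f) :=
    fun f h1 h2 h3 h4 =>
      { dist_eq := fun i j hij => dist_extremalPoint (h1 i j hij).1 (h1 i j hij).2
        dist_left := fun i hi => dist_extremalPoint (h2 i).1 (h3 i hi)
        left_ne := fun h => (h2 0).1 (extremalPoint_injective h)
        dist_right := fun i hi => dist_extremalPoint (h2 i).2 (h4 i hi)
        right_ne := fun h => (h2 1).2 (extremalPoint_injective h) }
  refine ⟨extremalPoint 0, extremalPoint 1, extremalPoint ∘ ![2, 3, 4, 5],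
    extremalPoint ∘ ![6, 7, 8, 9], aux _ (by decide) (by decide) (by decide) (by decide),
    aux _ (by decide) (by decide) (by decide) (by decide),
    dist_extremalPoint (by decide) (by decide), dist_extremalPoint (by decide) (by decide), ?_⟩
  rw [Set.range_comp, Set.range_comp, ← Set.image_pair, ← Set.image_union, ← Set.image_union,
    ← Set.image_univ]
  congr 1
  ext i
  fin_cases i <;> simp

/-- The coordinates of the simple vertices in terms of the central tetrahedron. -/
theorem IsBiaugmentedTetrahedron.apex {a b : E3} {x : Fin 4 → E3}
    (h : IsBiaugmentedTetrahedron a b x) (i : Fin 3) :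
    a i = 2 / 3 * (x 1 i + x 2 i + x 3 i) - x 0 i ∧
      b i = 2 / 3 * (x 0 i + x 2 i + x 3 i) - x 1 i :=
  ⟨add_eq_of_unit_tetrahedra h.left_ne (h.dist_eq _ _ (by decide)) (h.dist_eq _ _ (by decide))
    (h.dist_eq _ _ (by decide)) (h.dist_left _ (by decide)) (h.dist_left _ (by decide))
    (h.dist_left _ (by decide)) (h.dist_eq _ _ (by decide)) (h.dist_eq _ _ (by decide))
    (h.dist_eq _ _ (by decide)) i,
   add_eq_of_unit_tetrahedra h.right_ne (h.dist_eq _ _ (by decide)) (h.dist_eq _ _ (by decide))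
    (h.dist_eq _ _ (by decide)) (h.dist_right _ (by decide)) (h.dist_right _ (by decide))
    (h.dist_right _ (by decide)) (h.dist_eq _ _ (by decide)) (h.dist_eq _ _ (by decide))
    (h.dist_eq _ _ (by decide)) i⟩

/-! ### Uniqueness of the extremal configuration -/

theorem eq_or_eq_neg_of_orthogonal {u v d e : E3} (huv : LinearIndependent ℝ ![u, v])
    (hud : inner ℝ u d = 0) (hvd : inner ℝ v d = 0) (hue : inner ℝ u e = 0)
    (hve : inner ℝ v e = 0) (hd : inner ℝ d d = (1 : ℝ)) (he : inner ℝ e e = (1 : ℝ)) :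
    e = d ∨ e = -d := by
  obtain ⟨c, rfl⟩ := exists_smul_eq_of_orthogonal huv (by rintro rfl; simp at hd) hud hvd hue hve
  rw [real_inner_smul_left, inner_smul_right, hd, mul_one] at he
  rcases mul_self_eq_one_iff.1 he with rfl | rfl <;> simp

/-- A biaugmented tetrahedron in terms of its symmetries: `X` points from the midpoint of the
simple vertices to the midpoint of `x 0` and `x 1`, `d` is the edge from `x 3` to `x 2`, and the
third direction is the unit vector `(3 / 5) (a - b)`, as the simple vertices are `5 / 3` apart. -/
theorem IsBiaugmentedTetrahedron.exists_frame {a b : E3} {x : Fin 4 → E3}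
    (h : IsBiaugmentedTetrahedron a b x) : ∃ X d : E3,
    inner ℝ X X = (8 / 9 : ℝ) ∧ inner ℝ d d = (1 : ℝ) ∧ inner ℝ X d = (0 : ℝ) ∧
    inner ℝ X ((3 / 5 : ℝ) • (a - b)) = (0 : ℝ) ∧ inner ℝ d ((3 / 5 : ℝ) • (a - b)) = (0 : ℝ) ∧
    inner ℝ ((3 / 5 : ℝ) • (a - b)) ((3 / 5 : ℝ) • (a - b)) = (1 : ℝ) ∧
    x 0 - (1 / 2 : ℝ) • (a + b) = X - (1 / 2 : ℝ) • (3 / 5 : ℝ) • (a - b) ∧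
    x 1 - (1 / 2 : ℝ) • (a + b) = X + (1 / 2 : ℝ) • (3 / 5 : ℝ) • (a - b) ∧
    x 2 - (1 / 2 : ℝ) • (a + b) = (1 / 4 : ℝ) • X + (1 / 2 : ℝ) • d ∧
    x 3 - (1 / 2 : ℝ) • (a + b) = (1 / 4 : ℝ) • X - (1 / 2 : ℝ) • d := by
  have ha := fun i => (h.apex i).1
  have hb := fun i => (h.apex i).2
  have h01 := (dist_eq_one_iff _ _).1 (h.dist_eq 0 1 (by decide))
  have h02 := (dist_eq_one_iff _ _).1 (h.dist_eq 0 2 (by decide))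
  have h03 := (dist_eq_one_iff _ _).1 (h.dist_eq 0 3 (by decide))
  have h12 := (dist_eq_one_iff _ _).1 (h.dist_eq 1 2 (by decide))
  have h13 := (dist_eq_one_iff _ _).1 (h.dist_eq 1 3 (by decide))
  have h23 := (dist_eq_one_iff _ _).1 (h.dist_eq 2 3 (by decide))
  have hk : (3 / 5 : ℝ) • (a - b) = x 1 - x 0 := by
    ext i
    simp only [PiLp.sub_apply, PiLp.smul_apply, smul_eq_mul, ha, hb]
    ring
  refine ⟨(2 / 3 : ℝ) • (x 0 + x 1 - x 2 - x 3), x 2 - x 3, ?_⟩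
  rw [hk]
  simp only [inner_eq_coord, PiLp.sub_apply, PiLp.smul_apply, PiLp.add_apply, smul_eq_mul]
  refine ⟨?_, ?_, ?_, ?_, ?_, ?_, ?_, ?_, ?_, ?_⟩
  · linear_combination 4 / 9 * (h02 + h03 + h12 + h13 - h01 - h23)
  · linear_combination h23
  · linear_combination (h03 + h13 - h02 - h12) / 3
  · linear_combination (h12 + h13 - h02 - h03) / 3
  · linear_combination (h02 + h13 - h12 - h03) / 2
  · linear_combination h01
  all_goals
    ext i
    simp only [PiLp.sub_apply, PiLp.smul_apply, PiLp.add_apply, smul_eq_mul, ha, hb]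
    ring

theorem exists_orthonormalBasis_eq {u v w : E3} (huu : inner ℝ u u = (1 : ℝ))
    (hvv : inner ℝ v v = (1 : ℝ)) (hww : inner ℝ w w = (1 : ℝ)) (huv : inner ℝ u v = (0 : ℝ))
    (huw : inner ℝ u w = (0 : ℝ)) (hvw : inner ℝ v w = (0 : ℝ)) :
    ∃ e : OrthonormalBasis (Fin 3) ℝ E3, e 0 = u ∧ e 1 = v ∧ e 2 = w := by
  have norm_one : ∀ {x : E3}, inner ℝ x x = (1 : ℝ) → ‖x‖ = 1 := fun {x} hx => by
    rwa [real_inner_self_eq_norm_sq, pow_eq_one_iff_of_nonneg (norm_nonneg x) two_ne_zero] at hx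
  have hon : Orthonormal ℝ ![u, v, w] := by
    rw [orthonormal_iff_ite]
    intro i j
    fin_cases i <;> fin_cases j <;>
      simp [norm_one huu, norm_one hvv, norm_one hww, huv, huw, hvw,
        (real_inner_comm u v).trans huv, (real_inner_comm u w).trans huw,
        (real_inner_comm v w).trans hvw]
  have hsp : ⊤ ≤ Submodule.span ℝ (Set.range ![u, v, w]) := by
    rw [hon.linearIndependent.span_eq_top_of_card_eq_finrank (by simp)]
  exact ⟨OrthonormalBasis.mk hon hsp, by simp, by simp, by simp⟩

/-- Two families of points are congruent if the coordinates of the first in some orthonormal frame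
are those of the second in the standard one. -/
theorem congruentSets_range_of_frame {ι : Type*} {d : ℕ} (p q : ι → EuclideanSpace ℝ (Fin d))
    (o : EuclideanSpace ℝ (Fin d)) (e : OrthonormalBasis (Fin d) ℝ (EuclideanSpace ℝ (Fin d)))
    (h : ∀ i, p i - o = ∑ j, q i j • e j) : CongruentSets (Set.range p) (Set.range q) := by
  refine ⟨(IsometryEquiv.subRight o).trans e.repr.toIsometryEquiv, ?_⟩
  rw [← Set.range_comp]
  congr 1
  funext i
  simp [h, OrthonormalBasis.sum_repr_symm]

/-- A pair of biaugmented tetrahedra is congruent to the extremal configuration if the signs of its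
edge vectors `d` and `d'` are chosen as there. The orthonormal frame consists of the directions of
`X + Y`, `X - Y` and `k`. -/
theorem congruentSets_extremal_of_frames {a b : E3} {x y : Fin 4 → E3} {k X Y d d' o : E3}
    (hXX : inner ℝ X X = (8 / 9 : ℝ)) (hYY : inner ℝ Y Y = (8 / 9 : ℝ))
    (hkk : inner ℝ k k = (1 : ℝ)) (hXk : inner ℝ X k = (0 : ℝ)) (hYk : inner ℝ Y k = (0 : ℝ))
    (hXY : inner ℝ X Y = (7 / 18 : ℝ))
    (ha : a - o = (5 / 6 : ℝ) • k) (hb : b - o = (-5 / 6 : ℝ) • k)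
    (hx0 : x 0 - o = X - (1 / 2 : ℝ) • k) (hx1 : x 1 - o = X + (1 / 2 : ℝ) • k)
    (hx2 : x 2 - o = (1 / 4 : ℝ) • X + (1 / 2 : ℝ) • d)
    (hx3 : x 3 - o = (1 / 4 : ℝ) • X - (1 / 2 : ℝ) • d)
    (hy0 : y 0 - o = Y - (1 / 2 : ℝ) • k) (hy1 : y 1 - o = Y + (1 / 2 : ℝ) • k)
    (hy2 : y 2 - o = (1 / 4 : ℝ) • Y + (1 / 2 : ℝ) • d')
    (hy3 : y 3 - o = (1 / 4 : ℝ) • Y - (1 / 2 : ℝ) • d')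
    (hd : d = (-9 * √2 * √23 / 184) • (X + Y) + (√23 * √2 / 8) • (X - Y))
    (hd' : d' = (-9 * √2 * √23 / 184) • (X + Y) - (√23 * √2 / 8) • (X - Y)) :
    CongruentSets ({a, b} ∪ Set.range x ∪ Set.range y) (Set.range extremalPoint) := by
  have h23 : √23 ^ 2 = (23 : ℝ) := Real.sq_sqrt (by norm_num)
  have h23' : √23 ≠ 0 := by positivity
  have hYX : inner ℝ Y X = (7 / 18 : ℝ) := (real_inner_comm X Y).trans hXY
  obtain ⟨e, he0, he1, he2⟩ := exists_orthonormalBasis_eq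
    (u := (3 / √23) • (X + Y)) (v := X - Y) (w := k)
    (by simp only [inner_add_left, inner_add_right, real_inner_smul_left, inner_smul_right, hXX,
          hYY, hXY, hYX]
        field_simp; rw [h23]; norm_num)
    (by simp only [inner_sub_left, inner_sub_right, hXX, hYY, hXY, hYX]; norm_num) hkk
    (by simp only [inner_add_left, inner_sub_right, real_inner_smul_left, hXX, hYY, hXY, hYX]; ring)
    (by simp only [inner_add_left, real_inner_smul_left, hXk, hYk]; ring)
    (by simp only [inner_sub_left, hXk, hYk]; ring)
  have hsum : X + Y = (√23 / 3) • e 0 := by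
    rw [he0, smul_smul]; field_simp; simp
  have hX : X = (√23 / 6) • e 0 + (1 / 2 : ℝ) • e 1 := by
    rw [show X = (1 / 2 : ℝ) • (X + Y) + (1 / 2 : ℝ) • (X - Y) by module, hsum, he1]; module
  have hY : Y = (√23 / 6) • e 0 - (1 / 2 : ℝ) • e 1 := by
    rw [show Y = (1 / 2 : ℝ) • (X + Y) - (1 / 2 : ℝ) • (X - Y) by module, hsum, he1]; module
  have hc : -9 * √2 * √23 / 184 * (√23 / 3) = -3 * √2 / 8 := by
    linear_combination -3 * √2 / 184 * h23
  rw [hsum, smul_smul, hc, ← he1] at hd hd'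
  subst he2
  have hV : ({a, b} ∪ Set.range x ∪ Set.range y : Set E3) =
      Set.range ![a, b, x 0, x 1, x 2, x 3, y 0, y 1, y 2, y 3] := by
    ext z
    simp [Fin.exists_fin_succ, eq_comm, or_assoc]
    tauto
  rw [hV]
  refine congruentSets_range_of_frame _ _ o e fun i => ?_
  rw [Fin.sum_univ_three]
  fin_cases i <;> 
    simp [extremalPoint, ha, hb, hx0, hx1, hx2, hx3, hy0, hy1, hy2, hy3, hd, hd', hX, hY]
  all_goals module

theorem inner_self_combination {X Y : E3} {s t : ℝ} (hXX : inner ℝ X X = (8 / 9 : ℝ))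
    (hYY : inner ℝ Y Y = (8 / 9 : ℝ)) (hXY : inner ℝ X Y = (7 / 18 : ℝ)) :
    (inner ℝ (s • (X + Y) + t • (X - Y)) (s • (X + Y) + t • (X - Y)) : ℝ) =
      23 / 9 * s ^ 2 + t ^ 2 := by
  have hYX : inner ℝ Y X = (7 / 18 : ℝ) := (real_inner_comm X Y).trans hXY
  simp only [inner_add_left, inner_add_right, inner_sub_left, inner_sub_right,
    real_inner_smul_left, inner_smul_right, hXX, hYY, hXY, hYX]
  ring

/-- There are only two unit vectors orthogonal to `X` and `k`. By `h₁` and `h₂` they are the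
combination of `X + Y` and `X - Y` with coefficients `s` and `t`, and its negative. -/
theorem eq_or_eq_neg_of_frame {X Y d k : E3} {s t : ℝ} (hXX : inner ℝ X X = (8 / 9 : ℝ))
    (hYY : inner ℝ Y Y = (8 / 9 : ℝ)) (hXY : inner ℝ X Y = (7 / 18 : ℝ))
    (hkk : inner ℝ k k = (1 : ℝ)) (hXk : inner ℝ X k = (0 : ℝ)) (hYk : inner ℝ Y k = (0 : ℝ))
    (hdd : inner ℝ d d = (1 : ℝ)) (hXd : inner ℝ X d = (0 : ℝ)) (hdk : inner ℝ d k = (0 : ℝ))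
    (h₁ : 23 * s + 9 * t = 0) (h₂ : 23 / 9 * s ^ 2 + t ^ 2 = 1) :
    d = s • (X + Y) + t • (X - Y) ∨ d = -(s • (X + Y) + t • (X - Y)) := by
  have hli : LinearIndependent ℝ ![X, k] := by
    apply linearIndependent_pair_of_gram
    rw [hXX, hkk, hXk]; norm_num
  apply eq_or_eq_neg_of_orthogonal hli _ _ hXd ((real_inner_comm _ _).trans hdk) _ hdd
  · simp only [inner_add_right, inner_sub_right, inner_smul_right, hXX, hXY]
    linear_combination h₁ / 18
  · have h : inner ℝ k X = (0 : ℝ) := (real_inner_comm _ _).trans hXk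
    have h' : inner ℝ k Y = (0 : ℝ) := (real_inner_comm _ _).trans hYk
    simp only [inner_add_right, inner_sub_right, inner_smul_right, h, h']
    ring
  · rw [inner_self_combination hXX hYY hXY, h₂]

/-- Changing the sign of the edge vector from `x 3` to `x 2` exchanges these two vertices. -/
theorem exists_relabelling {x : Fin 4 → E3} {o u d e : E3} (h2 : x 2 - o = u + (1 / 2 : ℝ) • d)
    (h3 : x 3 - o = u - (1 / 2 : ℝ) • d) (h : d = e ∨ d = -e) :
    ∃ x' : Fin 4 → E3, Set.range x' = Set.range x ∧ x' 0 = x 0 ∧ x' 1 = x 1 ∧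
      x' 2 - o = u + (1 / 2 : ℝ) • e ∧ x' 3 - o = u - (1 / 2 : ℝ) • e := by
  rcases h with rfl | rfl
  · exact ⟨x, rfl, rfl, rfl, h2, h3⟩
  · refine ⟨x ∘ Equiv.swap 2 3, (Equiv.swap 2 3).surjective.range_comp x, rfl, rfl, ?_, ?_⟩
    · rw [Function.comp_apply, Equiv.swap_apply_left, h3]; module
    · rw [Function.comp_apply, Equiv.swap_apply_right, h2]; module

/-- Pairs of biaugmented tetrahedra are unique up to congruence: `dist (x 0) (y 0) = 1` fixes the
angle between the vectors `X` and `Y`, and the edge vectors are then determined up to sign. -/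
theorem IsPairOfBiaugmentedTetrahedra.congruentSets_extremal {V : Set E3}
    (h : IsPairOfBiaugmentedTetrahedra V) : CongruentSets V (Set.range extremalPoint) := by
  obtain ⟨a, b, x, y, hx, hy, h0, -, rfl⟩ := h
  obtain ⟨X, d, hXX, hdd, hXd, hXk, hdk, hkk, hx0, hx1, hx2, hx3⟩ := hx.exists_frame
  obtain ⟨Y, d', hYY, hdd', hYd', hYk, hdk', -, hy0, hy1, hy2, hy3⟩ := hy.exists_frame
  have hXY : (inner ℝ X Y : ℝ) = 7 / 18 := by
    have e : x 0 - y 0 = X - Y := by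
      rw [← sub_sub_sub_cancel_right (x 0) (y 0) ((1 / 2 : ℝ) • (a + b)), hx0, hy0]; abel
    rw [dist_eq_norm, e] at h0
    have := norm_sub_sq_real X Y
    rw [h0, ← real_inner_self_eq_norm_sq, ← real_inner_self_eq_norm_sq, hXX, hYY] at this
    linarith
  have hYX : inner ℝ Y X = (7 / 18 : ℝ) := (real_inner_comm X Y).trans hXY
  have h23 : √23 ^ 2 = (23 : ℝ) := Real.sq_sqrt (by norm_num)
  have h2 : √2 ^ 2 = (2 : ℝ) := Real.sq_sqrt (by norm_num)
  have e₁ : 23 * (-9 * √2 * √23 / 184) + 9 * (√23 * √2 / 8) = 0 := by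
    ring
  have e₂ : 23 / 9 * (-9 * √2 * √23 / 184) ^ 2 + (√23 * √2 / 8) ^ 2 = 1 := by
    linear_combination (207 / 184 ^ 2 + 1 / 64) * (√23 ^ 2 * h2 + 2 * h23)
  obtain ⟨x', hx', hx'0, hx'1, hx'2, hx'3⟩ := exists_relabelling hx2 hx3
    (eq_or_eq_neg_of_frame hXX hYY hXY hkk hXk hYk hdd hXd hdk e₁ e₂)
  obtain ⟨y', hy', hy'0, hy'1, hy'2, hy'3⟩ := exists_relabelling hy2 hy3
    (eq_or_eq_neg_of_frame hYY hXX hYX hkk hYk hXk hdd' hYd' hdk' e₁ e₂)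
  rw [← hx', ← hy']
  exact congruentSets_extremal_of_frames hXX hYY hkk hXk hYk hXY (by module) (by module)
    (by rw [hx'0, hx0]) (by rw [hx'1, hx1]) hx'2 hx'3 (by rw [hy'0, hy0]) (by rw [hy'1, hy1])
    hy'2 hy'3 rfl (by module)

/-! ### Graphs packed into natural numbers -/

namespace PackedGraph

/-- The value `k x`, in a form that makes the kernel evaluate the number `x` before it enters `k`,
since the recursor has to inspect it. -/
def force (x : ℕ) (k : ℕ → Bool) : Bool :=
  Nat.rec (k 0) (fun m _ => k (Nat.succ m)) x

theorem force_eq (x : ℕ) (k : ℕ → Bool) : force x k = k x := by cases x <;> rfl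

/-- A graph on at most `16` vertices is encoded by its adjacency matrix, written with `16` bits to
a row in one natural number `A`; this is the row of the vertex `v`, as a bit mask. -/
def row (A v : ℕ) : ℕ := Nat.land (Nat.shiftRight A (Nat.mul 16 v)) 65535

theorem testBit_row (A v j : ℕ) :
    (row A v).testBit j = true ↔ j < 16 ∧ A.testBit (16 * v + j) = true := by
  change ((A >>> (16 * v)) &&& (2 ^ 16 - 1)).testBit j = true ↔ _
  rw [Nat.testBit_and, Nat.testBit_shiftRight, Nat.testBit_two_pow_sub_one]
  simp [and_comm]

/-- Whether `t v c'` holds for some bit `v` of the mask `c`, where `c'` holds the bits of `c` below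
`v`. At most `fuel` bits are tried, from the highest down. -/
noncomputable def anyBit (t : ℕ → ℕ → Bool) (fuel c : ℕ) : Bool :=
  Nat.rec (fun _ => false)
    (fun _ ih c => bif Nat.beq c 0 then false else
      force (Nat.log2 c) fun v => force (Nat.xor c (Nat.pow 2 v)) fun c' => or (t v c') (ih c'))
    fuel c

theorem testBit_clear {c v : ℕ} (hc : c.testBit v = true) (j : ℕ) :
    (Nat.xor c (Nat.pow 2 v)).testBit j = true ↔ c.testBit j = true ∧ j ≠ v := by
  change (c ^^^ 2 ^ v).testBit j = true ↔ _
  rw [Nat.testBit_xor, Nat.testBit_two_pow]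
  by_cases h : v = j
  · subst h; simp [hc]
  · simp [h, Ne.symm h]

theorem exists_of_anyBit {t : ℕ → ℕ → Bool} {fuel c : ℕ} (h : anyBit t fuel c = true) :
    ∃ v c', c.testBit v = true ∧ t v c' = true ∧
      ∀ j, c'.testBit j = true → c.testBit j = true ∧ j ≠ v := by
  induction fuel generalizing c with
  | zero => exact absurd h (by simp [anyBit])
  | succ f ih =>
    change (bif Nat.beq c 0 then false else force (Nat.log2 c) fun v =>
      force (Nat.xor c (Nat.pow 2 v)) fun c' => or (t v c') (anyBit t f c')) = true at h
    rcases eq_or_ne c 0 with rfl | hc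
    · exact absurd h (by simp)
    have hb : Nat.beq c 0 = false := by cases c <;> [exact absurd rfl hc; rfl]
    rw [hb, cond_false, force_eq, force_eq, Bool.or_eq_true] at h
    rcases h with h | h
    · exact ⟨_, _, Nat.testBit_log2 hc, h, fun j hj => (testBit_clear (Nat.testBit_log2 hc) j).1 hj⟩
    · obtain ⟨v, c', hv, ht, hc'⟩ := ih h
      have aux := fun j => (testBit_clear (Nat.testBit_log2 hc) j).1
      exact ⟨v, c', (aux v hv).1, ht, fun j hj => ⟨(aux j (hc' j hj).1).1, (hc' j hj).2⟩⟩

/-- The number `A` is the packed adjacency matrix of the relation `R` on the vertices below `n`. -/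
def Encodes (R : ℕ → ℕ → Prop) (n A : ℕ) : Prop :=
  ∀ v j, j < 16 → (A.testBit (16 * v + j) = true ↔ v < n ∧ j < n ∧ R v j)

variable {R : ℕ → ℕ → Prop} {n A : ℕ}

theorem Encodes.testBit_row (hA : Encodes R n A) {v j : ℕ} (h : (row A v).testBit j = true) :
    v < n ∧ j < n ∧ R v j := by
  rw [PackedGraph.testBit_row] at h
  exact (hA v j h.1).1 h.2

/-- Whether the graph `A` has a clique of size `k` inside the mask `c`. -/
noncomputable def hasClique (A k c : ℕ) : Bool :=
  Nat.rec (fun _ => true)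
    (fun _ ih c => anyBit (fun v c' => force (Nat.land c' (row A v)) ih) 16 c) k c

theorem Encodes.exists_of_hasClique (hA : Encodes R n A) {k c : ℕ} (h : hasClique A k c = true) :
    ∃ l : List ℕ, l.length = k ∧ l.Pairwise R ∧ ∀ v ∈ l, c.testBit v = true := by
  induction k generalizing c with
  | zero => exact ⟨[], rfl, List.Pairwise.nil, by simp⟩
  | succ k ih =>
    change anyBit (fun v c' => force (Nat.land c' (row A v)) (hasClique A k)) 16 c = true at h
    obtain ⟨v, c', hv, ht, hc'⟩ := exists_of_anyBit h
    rw [force_eq] at ht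
    obtain ⟨l, hl, hp, hm⟩ := ih ht
    have hm' : ∀ w ∈ l, c'.testBit w = true ∧ (row A v).testBit w = true := fun w hw => by
      have := hm w hw
      change (c' &&& row A v).testBit w = true at this
      simpa [Nat.testBit_and] using this
    refine ⟨v :: l, by simp [hl], List.pairwise_cons.2
      ⟨fun w hw => (hA.testBit_row (hm' w hw).2).2.2, hp⟩, ?_⟩
    intro w hw
    rcases List.mem_cons.1 hw with rfl | hw
    · exact hv
    · exact (hc' w (hm' w hw).1).1

/-- The mask `c` without its highest bit. -/
def dropTop (c : ℕ) : ℕ := Nat.xor c (Nat.pow 2 (Nat.log2 c))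

/-- Whether the mask `c` has at least three bits and `b` holds. The argument `b` is evaluated only
if the mask passes. -/
def threeBitsAnd (c : ℕ) (b : Bool) : Bool :=
  bif Nat.beq c 0 then false else force (dropTop c) fun c => bif Nat.beq c 0 then false else
    bif Nat.beq (dropTop c) 0 then false else b

theorem exists_of_threeBitsAnd {c : ℕ} {b : Bool} (h : threeBitsAnd c b = true) :
    b = true ∧ ∃ x y z, x ≠ y ∧ x ≠ z ∧ y ≠ z ∧
      c.testBit x = true ∧ c.testBit y = true ∧ c.testBit z = true := by
  have drop : ∀ {c j : ℕ}, c ≠ 0 → (dropTop c).testBit j = true → c.testBit j = true ∧ j ≠ c.log2 :=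
    fun hc => (testBit_clear (Nat.testBit_log2 hc) _).1
  rw [threeBitsAnd, force_eq] at h
  by_cases h1 : c = 0
  · simp [h1] at h
  by_cases h2 : dropTop c = 0
  · simp [h2] at h
  by_cases h3 : dropTop (dropTop c) = 0
  · simp [h3] at h
  simp only [Bool.cond_eq_ite] at h
  refine ⟨by simp_all, ?_⟩
  obtain ⟨a2, b2⟩ := drop h1 (Nat.testBit_log2 h2)
  obtain ⟨a3, b3⟩ := drop h2 (Nat.testBit_log2 h3)
  obtain ⟨a4, b4⟩ := drop h1 a3
  exact ⟨_, _, _, b2.symm, b4.symm, b3.symm, Nat.testBit_log2 h1, a2, a4⟩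

/-- Whether two vertices below `n` of the graph `A` have three common neighbours in the mask `g`.
-/
noncomputable def hasBiclique (A n g : ℕ) : Bool :=
  Nat.rec false (fun a iha => or
    (force (Nat.land g (row A a)) fun c => threeBitsAnd c <|
      Nat.rec false (fun b ihb => or
        (force (Nat.land c (row A b)) fun c => threeBitsAnd c true) ihb) a) iha) n

theorem Encodes.exists_of_hasBiclique (hA : Encodes R n A) {m g : ℕ}
    (h : hasBiclique A m g = true) :
    ∃ a b x y z, a ≠ b ∧ a < n ∧ b < n ∧ x ≠ y ∧ x ≠ z ∧ y ≠ z ∧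
      ∀ w ∈ [x, y, z], g.testBit w = true ∧ R a w ∧ R b w := by
  induction m with
  | zero => exact absurd h (by simp [hasBiclique])
  | succ a iha =>
    rcases Bool.or_eq_true _ _ ▸ h with h | h
    swap
    · exact iha h
    rw [force_eq] at h
    have h := (exists_of_threeBitsAnd h).1
    have key : ∀ m, m ≤ a → Nat.rec false (fun b ihb => or (force (Nat.land
        (Nat.land g (row A a)) (row A b)) fun c => threeBitsAnd c true) ihb) m = true →
        ∃ b, b < a ∧ ∃ x y z, x ≠ y ∧ x ≠ z ∧ y ≠ z ∧
          ∀ w ∈ [x, y, z], g.testBit w = true ∧ (row A a).testBit w = true ∧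
            (row A b).testBit w = true := by
      intro m hm h
      induction m with
      | zero => exact absurd h (by simp)
      | succ b ihb =>
        rcases Bool.or_eq_true _ _ ▸ h with h | h
        · rw [force_eq] at h
          obtain ⟨-, x, y, z, hxy, hxz, hyz, hx, hy, hz⟩ := exists_of_threeBitsAnd h
          refine ⟨b, hm, x, y, z, hxy, hxz, hyz, fun w hw => ?_⟩
          have : ((g &&& row A a) &&& row A b).testBit w = true := by
            simp only [List.mem_cons, List.not_mem_nil, or_false] at hw
            rcases hw with rfl | rfl | rfl <;> assumption
          simpa [Nat.testBit_and, and_assoc] using this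
        · exact ihb (by omega) h
    obtain ⟨b, hb, x, y, z, hxy, hxz, hyz, hw⟩ := key a le_rfl h
    have hx := hw x (by simp)
    exact ⟨a, b, x, y, z, hb.ne', (hA.testBit_row hx.2.1).1, (hA.testBit_row hx.2.2).1, hxy, hxz,
      hyz, fun w hw' => ⟨(hw w hw').1, (hA.testBit_row (hw w hw').2.1).2.2,
        (hA.testBit_row (hw w hw').2.2).2.2⟩⟩

/-! ### Searching for extensions and patterns -/

/-- Checks `t` for all neighbourhoods of a new vertex `n` in the graph `A`, as far as the vertices
from `j` to `i + j - 1` are concerned. The mask `g` collects the neighbours, `A'` is the matrix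
with the new column entered, and `avail` is the set of vertices that may still be non-neighbours:
as non-neighbours are adjacent to each other, it shrinks to the row of each non-neighbour. -/
noncomputable def forallExt (A n : ℕ) (t : ℕ → ℕ → ℕ → Bool) (i j avail g A' : ℕ) : Bool :=
  Nat.rec (fun _ avail g A' => t avail g A')
    (fun _ ih j avail g A' => force j fun j =>
      and (ih (Nat.succ j) avail (Nat.lor g (Nat.pow 2 j))
          (Nat.lor A' (Nat.pow 2 (Nat.add (Nat.mul 16 j) n))))
        (bif Nat.beq (Nat.land avail (Nat.pow 2 j)) 0 then true
          else ih (Nat.succ j) (Nat.land avail (row A j)) g A'))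
    i j avail g A'

/-- The neighbourhood that `R` assigns to the vertex `n` is one of those that `forallExt`
visits. -/
theorem Encodes.exists_of_forallExt (hA : Encodes R n A) {N : ℕ} (hN : N ≤ 16) (hn : n < N)
    (hsymm : ∀ v w, R v w → R w v)
    (htri : ∀ u v w, u < v → v < w → w < N → R u v ∨ R u w ∨ R v w)
    {t : ℕ → ℕ → ℕ → Bool} {i j avail g A' : ℕ} (hij : i + j ≤ n)
    (havail : ∀ w, j ≤ w → w < n → ¬ R n w → avail.testBit w = true)
    (h : forallExt A n t i j avail g A' = true) :
    ∃ avail' g' A'', t avail' g' A'' = true ∧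
      (∀ w, i + j ≤ w → w < n → ¬ R n w → avail'.testBit w = true) ∧
      (∀ w, g'.testBit w = true ↔ g.testBit w = true ∨ j ≤ w ∧ w < i + j ∧ R n w) ∧
      (∀ m, A''.testBit m = true ↔
        A'.testBit m = true ∨ ∃ w, j ≤ w ∧ w < i + j ∧ R n w ∧ m = 16 * w + n) := by
  induction i generalizing j avail g A' with
  | zero =>
    refine ⟨avail, g, A', h, fun w hw => havail w (by omega), fun w => ?_, fun m => ?_⟩
    · constructor
      · exact Or.inl
      · rintro (h | h)
        · exact h
        · omega
    · constructor
      · exact Or.inl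
      · rintro (h | ⟨w, h1, h2, -⟩)
        · exact h
        · omega
  | succ i ih =>
    change force j (fun j => and (forallExt A n t i (Nat.succ j) avail (Nat.lor g (Nat.pow 2 j))
          (Nat.lor A' (Nat.pow 2 (Nat.add (Nat.mul 16 j) n))))
        (bif Nat.beq (Nat.land avail (Nat.pow 2 j)) 0 then true
          else forallExt A n t i (Nat.succ j) (Nat.land avail (row A j)) g A')) = true at h
    rw [force_eq, Bool.and_eq_true] at h
    have hstep : ∀ w, j ≤ w ∧ w < i + 1 + j ↔ w = j ∨ j + 1 ≤ w ∧ w < i + (j + 1) := by omega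
    by_cases hR : R n j
    · obtain ⟨a, g', A'', ht, h1, h2, h3⟩ := ih (by omega)
        (fun w hw => havail w (by omega)) h.1
      refine ⟨a, g', A'', ht, fun w hw => h1 w (by omega), fun w => ?_, fun m => ?_⟩
      · rw [h2 w]
        change (g ||| 2 ^ j).testBit w = true ∨ _ ↔ _
        rw [Nat.testBit_or, Bool.or_eq_true, Nat.testBit_two_pow, decide_eq_true_eq]
        have := hstep w
        constructor
        · rintro ((h | rfl) | h)
          · exact Or.inl h
          · exact Or.inr ⟨by omega, by omega, hR⟩
          · exact Or.inr ⟨by omega, by omega, h.2.2⟩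
        · rintro (h | ⟨ha, hb, hc⟩)
          · exact Or.inl (Or.inl h)
          · rcases this.1 ⟨ha, hb⟩ with rfl | h
            · exact Or.inl (Or.inr rfl)
            · exact Or.inr ⟨h.1, h.2, hc⟩
      · rw [h3 m]
        change (A' ||| 2 ^ (16 * j + n)).testBit m = true ∨ _ ↔ _
        rw [Nat.testBit_or, Bool.or_eq_true, Nat.testBit_two_pow, decide_eq_true_eq]
        constructor
        · rintro ((h | rfl) | ⟨w, ha, hb, hc, hd⟩)
          · exact Or.inl h
          · exact Or.inr ⟨j, le_rfl, by omega, hR, rfl⟩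
          · exact Or.inr ⟨w, by omega, by omega, hc, hd⟩
        · rintro (h | ⟨w, ha, hb, hc, hd⟩)
          · exact Or.inl (Or.inl h)
          · rcases (hstep w).1 ⟨ha, hb⟩ with rfl | h
            · exact Or.inl (Or.inr hd.symm)
            · exact Or.inr ⟨w, h.1, h.2, hc, hd⟩
    · have hj : avail.testBit j = true := havail j le_rfl (by omega) hR
      have hb : Nat.beq (Nat.land avail (Nat.pow 2 j)) 0 = false := by
        have : avail &&& 2 ^ j ≠ 0 := fun h0 => by
          have := congrArg (fun x => Nat.testBit x j) h0
          simp [Nat.testBit_and, hj] at this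
        generalize hm : Nat.land avail (Nat.pow 2 j) = m
        cases m with
        | zero => exact absurd hm this
        | succ m => rfl
      have h := h.2
      rw [hb, cond_false] at h
      obtain ⟨a, g', A'', ht, h1, h2, h3⟩ := ih (by omega) (fun w hw hwn hRw => by
        change (avail &&& row A j).testBit w = true
        rw [Nat.testBit_and, Bool.and_eq_true, PackedGraph.testBit_row, hA j w (by omega)]
        refine ⟨havail w (by omega) hwn hRw, by omega, by omega, hwn, ?_⟩
        rcases htri j w n (by omega) hwn hn with h | h | h
        · exact h
        · exact absurd (hsymm _ _ h) hR
        · exact absurd (hsymm _ _ h) hRw) h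
      have hne : ∀ w, R n w → w ≠ j := by rintro w hw rfl; exact hR hw
      refine ⟨a, g', A'', ht, fun w hw => h1 w (by omega), fun w => ?_, fun m => ?_⟩
      · rw [h2 w]
        have := hstep w
        have := hne w
        constructor
        · rintro (h | h)
          · exact Or.inl h
          · exact Or.inr ⟨by omega, by omega, h.2.2⟩
        · rintro (h | ⟨ha, hb, hc⟩)
          · exact Or.inl h
          · exact Or.inr ⟨by have := hne w hc; omega, by omega, hc⟩
      · rw [h3 m]
        constructor
        · rintro (h | ⟨w, ha, hb, hc, hd⟩)
          · exact Or.inl h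
          · exact Or.inr ⟨w, by omega, by omega, hc, hd⟩
        · rintro (h | ⟨w, ha, hb, hc, hd⟩)
          · exact Or.inl h
          · exact Or.inr ⟨w, by have := hne w hc; omega, by omega, hc, hd⟩

/-- Checks `leaf` for all graphs that arise from the graph `A` on `n` vertices by adding `f`
vertices under these restrictions: no three vertices, one of them new, are pairwise non-adjacent,
no five are pairwise adjacent, there is no `K₃,₃`, and the adjacencies of the new vertices with the
vertices `0, 1, 2, 3`, read as binary numbers, decrease weakly, starting at or below `last`. The
last restriction costs no generality and removes most of the symmetry. -/
noncomputable def search (leaf : ℕ → Bool) (f n last A : ℕ) : Bool :=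
  Nat.rec (fun _ _ A => leaf A)
    (fun _ ih n last A =>
      forallExt A n (fun avail l A' => force l fun l => force avail fun avail => force A' fun A' =>
        or (Nat.blt last l) <|
          forallExt A n (fun _ g A' => force g fun g =>
            or (hasClique A 4 g) <| or (hasBiclique A n g) <|
              force (Nat.lor A' (Nat.shiftLeft g (Nat.mul 16 n))) fun A' => ih (Nat.succ n) l A')
            (Nat.sub n 4) 4 avail l A')
        4 0 65535 0 A)
    f n last A

theorem search_succ (leaf : ℕ → Bool) (f n last A : ℕ) : search leaf (f + 1) n last A =
    forallExt A n (fun avail l A' => force l fun l => force avail fun avail => force A' fun A' =>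
      or (Nat.blt last l) <|
        forallExt A n (fun _ g A' => force g fun g =>
          or (hasClique A 4 g) <| or (hasBiclique A n g) <|
            force (Nat.lor A' (Nat.shiftLeft g (Nat.mul 16 n))) fun A' =>
              search leaf f (Nat.succ n) l A')
          (Nat.sub n 4) 4 avail l A')
      4 0 65535 0 A := rfl

/-- Soundness of the search: a relation that satisfies its restrictions is encoded by a matrix that
passes `leaf`. -/
theorem Encodes.exists_of_search {N : ℕ} (hN : N ≤ 16) (hsymm : ∀ v w, R v w → R w v)
    (hirr : ∀ v, ¬ R v v)
    (htri : ∀ u v w, u < v → v < w → w < N → R u v ∨ R u w ∨ R v w)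
    (hclique : ∀ l : List ℕ, l.length = 5 → (∀ v ∈ l, v < N) → ¬ l.Pairwise R)
    (hbiclique : ∀ a b c x y z, a < N → b < N → c < N → x < N → y < N → z < N → a ≠ b → a ≠ c →
      b ≠ c → x ≠ y → x ≠ z → y ≠ z → ¬ ∀ w ∈ [x, y, z], R a w ∧ R b w ∧ R c w)
    {code : ℕ → ℕ} (hcode : ∀ v w, (code v).testBit w = true ↔ w < 4 ∧ R v w)
    (hanti : ∀ v w, 4 ≤ v → v ≤ w → w < N → code w ≤ code v)
    {leaf : ℕ → Bool} {f n last A : ℕ} (hn : 4 ≤ n) (hf : f + n = N) (hA : Encodes R n A)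
    (hlast : n < N → code n ≤ last) (h : search leaf f n last A = true) :
    ∃ A', leaf A' = true ∧ Encodes R N A' := by
  induction f generalizing n last A with
  | zero => exact ⟨A, h, by rwa [← hf, zero_add]⟩
  | succ f ih =>
    rw [search_succ] at h
    have hnN : n < N := by omega
    obtain ⟨avail, l, A', h1, h2, h3, h4⟩ := hA.exists_of_forallExt hN hnN hsymm htri
      (i := 4) (j := 0) (avail := 65535) (g := 0) (A' := A) (by omega)
      (fun w _ hw _ => by
        change (2 ^ 16 - 1).testBit w = true
        rw [Nat.testBit_two_pow_sub_one]; simp; omega) h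
    rw [force_eq, force_eq, force_eq, Bool.or_eq_true] at h1
    have hl : l = code n := Nat.eq_of_testBit_eq fun w => by
      rw [Bool.eq_iff_iff, h3, hcode]; simp
    rcases h1 with h1 | h1
    · have : last < l := by simpa [Nat.blt] using h1
      have := hlast hnN
      omega
    obtain ⟨-, g, A'', h5, -, h6, h7⟩ := hA.exists_of_forallExt hN hnN hsymm htri
      (i := n - 4) (j := 4) (by omega) (fun w hw => h2 w (by omega)) h1
    have hg : ∀ w, g.testBit w = true ↔ w < n ∧ R n w := fun w => by
      rw [h6, h3]
      simp
      constructor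
      · rintro (⟨hw, h⟩ | ⟨hw, hw', h⟩)
        · exact ⟨by omega, h⟩
        · exact ⟨by omega, h⟩
      · rintro ⟨hw, h⟩
        rcases lt_or_ge w 4 with h' | h'
        · exact Or.inl ⟨h', h⟩
        · exact Or.inr ⟨h', by omega, h⟩
    rw [force_eq, Bool.or_eq_true, Bool.or_eq_true, force_eq] at h5
    rcases h5 with h5 | h5 | h5
    · obtain ⟨k, hk, hp, hm⟩ := hA.exists_of_hasClique h5
      refine absurd (List.pairwise_cons.2 ⟨fun w hw => ((hg w).1 (hm w hw)).2, hp⟩)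
        (hclique (n :: k) (by simp [hk]) ?_)
      intro v hv
      rcases List.mem_cons.1 hv with rfl | hv
      · exact hnN
      · exact ((hg v).1 (hm v hv)).1.trans hnN
    · obtain ⟨a, b, x, y, z, hab, ha, hb, hxy, hxz, hyz, hw⟩ := hA.exists_of_hasBiclique h5
      have hlt : ∀ w ∈ [x, y, z], w < N := fun w hw' => ((hg w).1 (hw w hw').1).1.trans hnN
      exact absurd (fun w hw' => ⟨((hg w).1 (hw w hw').1).2, (hw w hw').2⟩)
        (hbiclique n a b x y z hnN (ha.trans hnN) (hb.trans hnN) (hlt x (by simp))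
          (hlt y (by simp)) (hlt z (by simp)) ha.ne' hb.ne' hab hxy hxz hyz)
    · refine ih (by omega) (by omega) (fun v j hj => ?_) (fun hn' => ?_) h5
      · change (A'' ||| g <<< (16 * n)).testBit _ = true ↔ _
        rw [Nat.testBit_or, Bool.or_eq_true, h7, h4, hA v j hj, Nat.testBit_shiftLeft]
        have hshift : (decide (16 * n ≤ 16 * v + j) && g.testBit (16 * v + j - 16 * n)) = true ↔
            v = n ∧ j < n ∧ R n j := by
          rw [Bool.and_eq_true, decide_eq_true_eq, hg]
          constructor
          · rintro ⟨h1, h2, h3⟩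
            obtain rfl : v = n := by omega
            rw [Nat.add_sub_cancel_left] at h2 h3
            exact ⟨rfl, h2, h3⟩
          · rintro ⟨rfl, h2, h3⟩
            rw [Nat.add_sub_cancel_left]
            exact ⟨by omega, h2, h3⟩
        rw [hshift]
        constructor
        · rintro (((⟨ha, hb, hc⟩ | ⟨w, -, ha, hb, hc⟩) | ⟨w, -, ha, hb, hc⟩) | ⟨rfl, ha, hb⟩)
          · exact ⟨by omega, by omega, hc⟩
          · obtain ⟨rfl, rfl⟩ : w = v ∧ j = n := by omega
            exact ⟨by omega, by omega, hsymm _ _ hb⟩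
          · obtain ⟨rfl, rfl⟩ : w = v ∧ j = n := by omega
            exact ⟨by omega, by omega, hsymm _ _ hb⟩
          · exact ⟨by omega, by omega, hb⟩
        · rintro ⟨ha, hb, hc⟩
          rcases Nat.lt_succ_iff_lt_or_eq.1 ha with ha | rfl <;>
            rcases Nat.lt_succ_iff_lt_or_eq.1 hb with hb | rfl
          · exact Or.inl (Or.inl (Or.inl ⟨ha, hb, hc⟩))
          · rcases lt_or_ge v 4 with h' | h'
            · exact Or.inl (Or.inl (Or.inr ⟨v, by omega, by omega, hsymm _ _ hc, rfl⟩))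
            · exact Or.inl (Or.inr ⟨v, by omega, by omega, hsymm _ _ hc, rfl⟩)
          · exact Or.inr ⟨rfl, hb, hc⟩
          · exact absurd hc (hirr _)
      · rw [hl]
        exact hanti _ _ hn (Nat.le_succ n) hn'

/-- The vertices in the mask `c` that are adjacent to all images of the positions in `d`, given the
rows `I` of these images. -/
noncomputable def common (I : ℕ) (d : List ℕ) (c : ℕ) : ℕ :=
  List.rec (fun c => c) (fun i _ ih c => ih (Nat.land c (row I i))) d c

theorem of_testBit_common {I c v : ℕ} {d : List ℕ} (h : (common I d c).testBit v = true) :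
    c.testBit v = true ∧ ∀ i ∈ d, (row I i).testBit v = true := by
  induction d generalizing c with
  | nil => exact ⟨h, by simp⟩
  | cons i d ih =>
    obtain ⟨h1, h2⟩ := ih h
    change (c &&& row I i).testBit v = true at h1
    rw [Nat.testBit_and, Bool.and_eq_true] at h1
    exact ⟨h1.1, by simpa using ⟨h1.2, h2⟩⟩

/-- Whether the pattern `pat` can be placed in the graph `A`, position after position. The rows of
the vertices chosen for the first `k` positions are packed into `I`, and `avail` is the mask of the
vertices not yet used. For the form of a pattern see `Realizes`. -/
noncomputable def embeds (A : ℕ) (pat : List (List ℕ)) (k I avail : ℕ) : Bool :=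
  List.rec (fun _ _ _ => true)
    (fun d _ ih k I avail => force (common I d avail) fun c =>
      anyBit (fun v _ => force (Nat.lor I (Nat.shiftLeft (row A v) (Nat.mul 16 k))) fun I =>
        force (Nat.xor avail (Nat.pow 2 v)) fun a => ih (Nat.succ k) I a) 16 c)
    pat k I avail

end PackedGraph

/-- A pattern lists, for each of its positions, earlier positions. It is realized in `S`, from the
points `xs` of its initial positions on, if points of `S`, distinct from one another and from `xs`,
can be chosen for the other positions such that each one is related to those at the listed
positions. Further relations are allowed. -/
def Realizes {α : Type*} (R : α → α → Prop) (S : Set α) : List (List ℕ) → List α → Prop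
  | [], _ => True
  | d :: pat, xs => ∃ x ∈ S, x ∉ xs ∧ (∀ i ∈ d, ∀ y, xs[i]? = some y → R y x) ∧
      Realizes R S pat (xs ++ [x])

theorem Realizes.map {α β : Type*} {R : α → α → Prop} {R' : β → β → Prop} {S : Set α} {S' : Set β}
    {f : α → β} (hf : Set.InjOn f S) (hS : Set.MapsTo f S S') (hR : ∀ x y, R x y → R' (f x) (f y))
    {pat : List (List ℕ)} {xs : List α} (hxs : ∀ x ∈ xs, x ∈ S) (h : Realizes R S pat xs) :
    Realizes R' S' pat (xs.map f) := by
  induction pat generalizing xs with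
  | nil => trivial
  | cons d pat ih =>
    obtain ⟨x, hx, hxx, hd, h⟩ := h
    refine ⟨f x, hS hx, ?_, ?_, ?_⟩
    · intro hmem
      obtain ⟨y, hy, hyx⟩ := List.mem_map.1 hmem
      exact hxx (hf (hxs y hy) hx hyx ▸ hy)
    · intro i hi y hy
      rw [List.getElem?_map, Option.map_eq_some_iff] at hy
      obtain ⟨z, hz, rfl⟩ := hy
      exact hR _ _ (hd i hi z hz)
    · have := ih (xs := xs ++ [x]) (by
        intro y hy
        rcases List.mem_append.1 hy with hy | hy
        · exact hxs y hy
        · rwa [List.mem_singleton.1 hy]) h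
      simpa using this

namespace PackedGraph

variable {R : ℕ → ℕ → Prop} {n A : ℕ}

theorem Encodes.realizes_of_embeds (hA : Encodes R n A) {pat : List (List ℕ)} {k I avail : ℕ}
    {xs : List ℕ} (hk : xs.length = k) (hI : ∀ m, 16 * k ≤ m → I.testBit m = false)
    (hxs : ∀ i y, xs[i]? = some y → ∀ j, (row I i).testBit j = true → R y j)
    (havail : ∀ j, avail.testBit j = true → j < n ∧ j ∉ xs)
    (h : embeds A pat k I avail = true) : Realizes R {v | v < n} pat xs := by
  induction pat generalizing k I avail xs with
  | nil => trivial
  | cons d pat ih =>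
    change force (common I d avail) (fun c => anyBit (fun v _ =>
      force (Nat.lor I (Nat.shiftLeft (row A v) (Nat.mul 16 k))) fun I =>
        force (Nat.xor avail (Nat.pow 2 v)) fun a => embeds A pat (Nat.succ k) I a) 16 c) =
          true at h
    rw [force_eq] at h
    obtain ⟨v, -, hv, h, -⟩ := exists_of_anyBit h
    rw [force_eq, force_eq] at h
    obtain ⟨hv1, hv2⟩ := of_testBit_common hv
    have hI' : ∀ m, (Nat.lor I (Nat.shiftLeft (row A v) (Nat.mul 16 k))).testBit m = true ↔
        I.testBit m = true ∨ 16 * k ≤ m ∧ (row A v).testBit (m - 16 * k) = true := fun m => by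
      change (I ||| row A v <<< (16 * k)).testBit m = true ↔ _
      rw [Nat.testBit_or, Bool.or_eq_true, Nat.testBit_shiftLeft, Bool.and_eq_true]
      simp
    refine ⟨v, (havail v hv1).1, (havail v hv1).2, fun i hi y hy => hxs i y hy v (hv2 i hi),
      ih (by simp [hk]) (fun m hm => ?_) (fun i y hy j hj => ?_) (fun j hj => ?_) h⟩
    · rw [Bool.eq_false_iff, Ne, hI', PackedGraph.testBit_row]
      rintro (h | h)
      · rw [hI m (by omega)] at h; exact Bool.false_ne_true h
      · omega
    · rw [PackedGraph.testBit_row, hI'] at hj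
      rcases lt_trichotomy i k with hik | rfl | hik
      · rw [List.getElem?_append_left (by omega)] at hy
        refine hxs i y hy j ((PackedGraph.testBit_row _ _ _).2 ⟨hj.1, hj.2.resolve_right ?_⟩)
        omega
      · rw [← hk, List.getElem?_concat_length, Option.some_inj] at hy
        subst hy
        rcases hj.2 with h | h
        · rw [hI _ (by omega)] at h; exact absurd h Bool.false_ne_true
        · rw [Nat.add_sub_cancel_left] at h
          exact (hA.testBit_row h.2).2.2
      · rw [List.getElem?_eq_none (by simp; omega)] at hy
        exact absurd hy (by simp)
    · have := (testBit_clear hv1 j).1 hj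
      refine ⟨(havail j this.1).1, fun hmem => ?_⟩
      rcases List.mem_append.1 hmem with hmem | hmem
      · exact (havail j this.1).2 hmem
      · exact this.2 (List.mem_singleton.1 hmem)

/-- Whether one of the patterns can be placed in the graph `A` on `n` vertices. -/
noncomputable def realizesAny (n : ℕ) (pats : List (List (List ℕ))) (A : ℕ) : Bool :=
  List.rec false (fun p _ ih => or (embeds A p 0 0 (Nat.sub (Nat.pow 2 n) 1)) ih) pats

theorem Encodes.exists_of_realizesAny (hA : Encodes R n A) {pats : List (List (List ℕ))}
    (h : realizesAny n pats A = true) : ∃ pat ∈ pats, Realizes R {v | v < n} pat [] := by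
  induction pats with
  | nil => exact absurd h (by simp [realizesAny])
  | cons p pats ih =>
    rcases Bool.or_eq_true _ _ ▸ h with h | h
    · refine ⟨p, by simp, hA.realizes_of_embeds rfl (by simp) (by simp) (fun j hj => ?_) h⟩
      change (2 ^ n - 1).testBit j = true at hj
      rw [Nat.testBit_two_pow_sub_one, decide_eq_true_eq] at hj
      exact ⟨hj, by simp⟩
    · obtain ⟨pat, hp, h⟩ := ih h
      exact ⟨pat, by simp [hp], h⟩

end PackedGraph

/-! ### The exhaustive search -/

namespace PackedGraph

/-- The packed matrix of the complete graph on four vertices. -/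
def fourClique : ℕ := 14 + 2 ^ 16 * 13 + 2 ^ 32 * 11 + 2 ^ 48 * 7

/-- The graph excluded by `not_two_chains`, with the positions in the order
`p, q, a, b, c, d, r, s, e, f`. -/
def patternChains : List (List ℕ) :=
  [[], [0], [0, 1], [0, 1, 2], [0, 1, 2], [0, 1, 4], [2, 3], [2, 3, 6], [3, 6, 7], [8, 6, 7, 5, 4]]

/-- The graph of a pair of biaugmented tetrahedra, with the positions in the order
`x 2, x 3, x 0, x 1, a, b, y 0, y 1, y 2, y 3`. -/
def patternBiaugmented : List (List ℕ) :=
  [[], [0], [0, 1], [0, 1, 2], [0, 1, 3], [0, 1, 2], [2, 5], [3, 4, 6], [4, 5, 6, 7],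
    [4, 5, 6, 7, 8]]

/-- The graph excluded by `not_ring_of_five_tetrahedra`; the shared edges are the pairs of
positions `(0, 1), (2, 3), …, (8, 9)`. -/
def patternRing : List (List ℕ) :=
  [[], [0], [0, 1], [0, 1, 2], [2, 3], [2, 3, 4], [4, 5], [4, 5, 6], [6, 7, 0, 1], [6, 7, 0, 1, 8]]

/-- A graph on the two-element subsets of `{1, …, 5}`, in the order
`12, 13, 14, 23, 24, 34, 15, 25, 35, 45`, in which intersecting sets are adjacent. The subsets of
`{1, 2, 3, 4}` and those of `{1, 2, 3, 5}` form octahedra. -/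
def patternOctahedra : List (List ℕ) :=
  [[], [0], [0, 1], [0, 1], [0, 2, 3], [1, 2, 3, 4], [0, 1, 2], [0, 3, 4, 6], [1, 3, 5, 6, 7],
    [2, 4, 5, 6, 7, 8]]

/-- The patterns one of which occurs in each graph on ten vertices that the search finds. Their
order matters for speed only. -/
def patterns : List (List (List ℕ)) :=
  [patternChains, patternBiaugmented, patternRing, patternOctahedra]

/-- Every graph on eleven vertices within the restrictions of `search` contains
the first pattern. -/
theorem search_eleven : search (realizesAny 11 [patternChains]) 7 4 15 fourClique = true := by
  decide +kernel

/-- Every graph on ten vertices within the restrictions of `search` contains one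
of the patterns. -/
theorem search_ten : search (realizesAny 10 patterns) 6 4 15 fourClique = true := by
  decide +kernel

end PackedGraph

/-! ### From finite sets to packed graphs -/

namespace PackedGraph

theorem encodes_fourClique {R : ℕ → ℕ → Prop} (hirr : ∀ v, ¬ R v v)
    (h : ∀ v w, v < 4 → w < 4 → v ≠ w → R v w) : Encodes R 4 fourClique := by
  intro v j hj
  have key : ∀ v < 4, ∀ j < 16, fourClique.testBit (16 * v + j) = decide (j < 4 ∧ v ≠ j) := by
    decide +kernel
  rcases lt_or_ge v 4 with hv | hv
  · rw [key v hv j hj, decide_eq_true_eq]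
    refine ⟨fun hvj => ⟨hv, hvj.1, h v j hv hvj.1 hvj.2⟩, fun hvj => ⟨hvj.2.1, ?_⟩⟩
    rintro rfl
    exact hirr v hvj.2.2
  · rw [Nat.testBit_lt_two_pow (lt_of_lt_of_le (by decide +kernel : fourClique < 2 ^ 64)
      (Nat.pow_le_pow_right (by norm_num) (by omega)))]
    exact ⟨fun h => absurd h Bool.false_ne_true, fun h => absurd h.1 (by omega)⟩

end PackedGraph

/-- A case of Ramsey's theorem, `R(3, 4) ≤ 10`. -/
theorem exists_pairwise_four {α : Type*} {R : α → α → Prop} {S : Finset α}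
    (htri : ∀ x ∈ S, ∀ y ∈ S, ∀ z ∈ S, x ≠ y → x ≠ z → y ≠ z → R x y ∨ R x z ∨ R y z)
    (hS : 9 < S.card) : ∃ l : List α, l.length = 4 ∧ l.Nodup ∧ l.Pairwise R ∧ ∀ x ∈ l, x ∈ S := by
  classical
  have split : ∀ (T : Finset α) (v : α), v ∈ T →
      (T.filter fun w => w ≠ v ∧ R v w).card + (T.filter fun w => w ≠ v ∧ ¬ R v w).card + 1 =
        T.card := by
    intro T v hv
    rw [← Finset.filter_filter, ← Finset.filter_filter, Finset.card_filter_add_card_filter_not,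
      Finset.filter_ne', Finset.card_erase_add_one hv]
  -- The points that are not related to `v` are related to one another.
  have far : ∀ v ∈ S, ∀ x ∈ S, ∀ y ∈ S, x ≠ v ∧ ¬ R v x → y ≠ v ∧ ¬ R v y → x ≠ y → R x y :=
    fun v hv x hx y hy hvx hvy hxy =>
      ((htri v hv x hx y hy hvx.1.symm hvy.1.symm hxy).resolve_left hvx.2).resolve_left hvy.2
  obtain ⟨v, hv⟩ : S.Nonempty := Finset.card_pos.1 (by omega)
  have hsplit := split S v hv
  rcases le_or_gt 4 (S.filter fun w => w ≠ v ∧ ¬ R v w).card with hF | hF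
  · obtain ⟨F, hFS, hF⟩ := Finset.exists_subset_card_eq hF
    have hm : ∀ x ∈ F, x ∈ S ∧ x ≠ v ∧ ¬ R v x := fun x hx => by simpa using hFS hx
    refine ⟨F.toList, by simpa using hF, F.nodup_toList, ?_,
      fun x hx => (hm x (by simpa using hx)).1⟩
    refine F.nodup_toList.imp_of_mem fun {x y} hx hy hxy => ?_
    have hx := hm x (by simpa using hx)
    have hy := hm y (by simpa using hy)
    exact far v hv x hx.1 y hy.1 hx.2 hy.2 hxy
  obtain ⟨U, hU⟩ : ∃ U, U = S.filter fun w => w ≠ v ∧ R v w := ⟨_, rfl⟩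
  have hm : ∀ x ∈ U, x ∈ S ∧ x ≠ v ∧ R v x := fun x hx => by simpa [hU] using hx
  rw [← hU] at hsplit
  obtain ⟨u, hu⟩ : U.Nonempty := Finset.card_pos.1 (by omega)
  have hsplit' := split U u hu
  obtain ⟨huS, huv, hvu⟩ := hm u hu
  rcases le_or_gt 3 (U.filter fun w => w ≠ u ∧ ¬ R u w).card with hF | hF
  · obtain ⟨x, hx, y, hy, z, hz, hxy, hxz, hyz⟩ := Finset.two_lt_card.1 hF
    rw [Finset.mem_filter] at hx hy hz
    have hx' := hm x hx.1
    have hy' := hm y hy.1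
    have hz' := hm z hz.1
    refine ⟨[v, x, y, z], rfl, ?_, ?_, by simp [hv, hx', hy', hz']⟩
    · simp [hx'.2.1.symm, hy'.2.1.symm, hz'.2.1.symm, hxy, hxz, hyz]
    · simp [hx', hy', hz', far u huS x hx'.1 y hy'.1 hx.2 hy.2 hxy,
        far u huS x hx'.1 z hz'.1 hx.2 hz.2 hxz, far u huS y hy'.1 z hz'.1 hy.2 hz.2 hyz]
  · have hF : 2 < (U.filter fun w => w ≠ u ∧ R u w).card := by omega
    obtain ⟨x, hx, y, hy, z, hz, hxy, hxz, hyz⟩ := Finset.two_lt_card.1 hF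
    rw [Finset.mem_filter] at hx hy hz
    have hx' := hm x hx.1
    have hy' := hm y hy.1
    have hz' := hm z hz.1
    have close : ∀ x y, x ≠ y → R x y → x ∈ U → y ∈ U → x ≠ u ∧ R u x → y ≠ u ∧ R u y →
        ∃ l : List α, l.length = 4 ∧ l.Nodup ∧ l.Pairwise R ∧ ∀ x ∈ l, x ∈ S := by
      intro x y hxy hR hx hy hux huy
      have hx' := hm x hx
      have hy' := hm y hy
      refine ⟨[v, u, x, y], rfl, ?_, ?_, by simp [hv, huS, hx', hy']⟩
      · simp [hx'.2.1.symm, hy'.2.1.symm, huv.symm, hux.1.symm, huy.1.symm, hxy]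
      · simp [hx', hy', hvu, hux, huy, hR]
    rcases htri x hx'.1 y hy'.1 z hz'.1 hxy hxz hyz with h | h | h
    · exact close x y hxy h hx.1 hy.1 hx.2 hy.2
    · exact close x z hxz h hx.1 hz.1 hx.2 hz.2
    · exact close y z hyz h hy.1 hz.1 hy.2 hz.2

/-- Passage from a finite set to the search: a four-clique takes the positions `0, 1, 2, 3`, and
the other points are sorted by their adjacencies with it. -/
theorem exists_realizes_of_search {α : Type*} {R : α → α → Prop} {S : Finset α}
    (hsymm : ∀ x y, R x y → R y x) (hirr : ∀ x, ¬ R x x)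
    (htri : ∀ x ∈ S, ∀ y ∈ S, ∀ z ∈ S, x ≠ y → x ≠ z → y ≠ z → R x y ∨ R x z ∨ R y z)
    (hclique : ∀ l : List α, l.length = 5 → ¬ l.Pairwise R)
    (hbiclique : ∀ a b c x y z : α, a ≠ b → a ≠ c → b ≠ c → x ≠ y → x ≠ z → y ≠ z →
      ¬ ∀ w ∈ [x, y, z], R a w ∧ R b w ∧ R c w)
    {f : ℕ} (hS : S.card = f + 4) (hf : 6 ≤ f) (hf' : f ≤ 12) {pats : List (List (List ℕ))}
    (h : PackedGraph.search (PackedGraph.realizesAny (f + 4) pats) f 4 15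
      PackedGraph.fourClique = true) :
    ∃ pat ∈ pats, Realizes R (S : Set α) pat [] := by
  classical
  obtain ⟨l, hl, hnd, hp, hlS⟩ := exists_pairwise_four htri (by omega)
  obtain ⟨x₀, hx₀⟩ := List.exists_mem_of_length_pos (l := l) (by omega)
  -- The bits of `code x` record which points of the clique `l` are related to `x`.
  obtain ⟨code, hcode⟩ : ∃ code : α → ℕ, ∀ x w, (code x).testBit w = true ↔
      w < 4 ∧ R x (l.getD w x₀) :=
    ⟨fun x => Nat.ofBits fun i : Fin 4 => decide (R x (l.getD i x₀)), fun x w => by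
      rw [Nat.testBit_ofBits]
      split_ifs with hw <;> simp [hw]⟩
  obtain ⟨r, hr⟩ : ∃ r, r = (S \ l.toFinset).toList.insertionSort fun x y => code y ≤ code x :=
    ⟨_, rfl⟩
  have hrS : ∀ x, x ∈ r ↔ x ∈ S ∧ x ∉ l := fun x => by simp [hr]
  have hrnd : r.Nodup := by
    rw [hr, (List.perm_insertionSort _ _).nodup_iff]
    exact Finset.nodup_toList _
  have hrlen : r.length = f := by
    rw [hr, List.length_insertionSort, Finset.length_toList, Finset.card_sdiff_of_subset
      (fun x hx => hlS x (by simpa using hx)), List.toFinset_card_of_nodup hnd]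
    omega
  have hrs : r.Pairwise fun x y => code y ≤ code x := by
    have : Std.Total fun x y => code y ≤ code x := ⟨fun x y => le_total _ _⟩
    have : IsTrans α fun x y => code y ≤ code x := ⟨fun x y z h1 h2 => h2.trans h1⟩
    rw [hr]
    exact List.pairwise_insertionSort _ _
  obtain ⟨p, hpdef⟩ : ∃ p : ℕ → α, ∀ i, p i = (l ++ r).getD i x₀ := ⟨_, fun _ => rfl⟩
  have hlen : (l ++ r).length = f + 4 := by rw [List.length_append]; omega
  have hget : ∀ i (hi : i < f + 4), p i = (l ++ r)[i]'(hlen ▸ hi) := fun i hi => by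
    rw [hpdef, List.getD_eq_getElem]
  have hnd' : (l ++ r).Nodup := List.nodup_append'.2 ⟨hnd, hrnd,
    fun x hx hx' => ((hrS x).1 hx').2 hx⟩
  have hinj : ∀ i j, i < f + 4 → j < f + 4 → i ≠ j → p i ≠ p j := fun i j hi hj hij h => by
    rw [hget i hi, hget j hj] at h
    exact hij ((hnd'.getElem_inj_iff).1 h)
  have hmem : ∀ i, i < f + 4 → p i ∈ S := fun i hi => by
    rw [hget i hi]
    rcases List.mem_append.1 (List.getElem_mem (hlen.symm ▸ hi : i < (l ++ r).length)) with h | h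
    · exact hlS _ h
    · exact ((hrS _).1 h).1
  have hpl : ∀ i, i < 4 → p i = l.getD i x₀ := fun i hi => by
    rw [hpdef, List.getD_append _ _ _ _ (by omega)]
  have hpr : ∀ i (hi : i < f), p (i + 4) = r[i]'(hrlen ▸ hi) := fun i hi => by
    rw [hget _ (by omega), List.getElem_append_right (by omega)]
    simp [hl]
  obtain ⟨A, hleaf, hA⟩ := PackedGraph.Encodes.exists_of_search (R := fun i j => R (p i) (p j))
    (N := f + 4) (by omega) (fun _ _ h => hsymm _ _ h) (fun _ => hirr _)
    (fun u v w huv hvw hw => htri _ (hmem u (by omega)) _ (hmem v (by omega)) _ (hmem w hw)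
      (hinj _ _ (by omega) (by omega) (by omega)) (hinj _ _ (by omega) (by omega) (by omega))
      (hinj _ _ (by omega) (by omega) (by omega)))
    (fun m hm _ hpm => hclique (m.map p) (by simpa using hm) (List.pairwise_map.2 hpm))
    (fun a b c x y z ha hb hc hx hy hz hab hac hbc hxy hxz hyz hw =>
      hbiclique (p a) (p b) (p c) (p x) (p y) (p z) (hinj _ _ ha hb hab) (hinj _ _ ha hc hac)
        (hinj _ _ hb hc hbc) (hinj _ _ hx hy hxy) (hinj _ _ hx hz hxz) (hinj _ _ hy hz hyz)
        (by simpa using hw))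
    (code := fun i => code (p i))
    (fun v w => by
      rw [hcode]
      exact and_congr_right fun hw => by rw [hpl w hw])
    (fun v w hv hvw hw => by
      rcases hvw.eq_or_lt with rfl | hvw
      · rfl
      obtain ⟨v, rfl⟩ := Nat.exists_eq_add_of_le' hv
      obtain ⟨w, rfl⟩ := Nat.exists_eq_add_of_le' (hv.trans hvw.le)
      rw [hpr v (by omega), hpr w (by omega)]
      exact List.pairwise_iff_getElem.1 hrs v w _ _ (by omega))
    le_rfl rfl
    (PackedGraph.encodes_fourClique (fun _ => hirr _) fun v w hv hw hvw => by
      have aux : ∀ v w, v < w → w < 4 → R (p v) (p w) := fun v w hvw hw => by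
        rw [hpl v (by omega), hpl w hw, List.getD_eq_getElem _ _ (by omega),
          List.getD_eq_getElem _ _ (by omega)]
        exact List.pairwise_iff_getElem.1 hp v w _ _ hvw
      rcases lt_or_gt_of_ne hvw with hvw | hvw
      · exact aux v w hvw hw
      · exact hsymm _ _ (aux w v hvw hv))
    (fun _ => Nat.le_of_lt_succ (Nat.lt_pow_two_of_testBit (n := 4) _ fun w hw => by
      rw [Bool.eq_false_iff, Ne, hcode]
      omega)) h
  obtain ⟨pat, hpat, hreal⟩ := hA.exists_of_realizesAny hleaf
  exact ⟨pat, hpat, hreal.map (f := p)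
    (fun i hi j hj h => by_contra fun hij => hinj i j hi hj hij h) (fun i hi => hmem i hi)
    (fun _ _ h => h) (by simp)⟩

/-! ### Geometric meaning of the patterns -/

theorem not_realizes_patternChains {V : Set E3} :
    ¬ Realizes (fun x y : E3 => dist x y = 1) V PackedGraph.patternChains [] := by
  rintro ⟨p, -, -, -, q, -, -, e1, a, -, -, e2, b, -, -, e3, c, -, n4, e4, d, -, n5, e5, r, -, -,
    e6, s, -, -, e7, e, -, n8, e8, f, -, n9, e9, -⟩
  simp at e1 e2 e3 e4 e5 e6 e7 e8 e9 n4 n5 n8 n9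
  casesm* _ ∧ _
  apply not_two_chains (p := p) (q := q) (r := r) (s := s) (a := a) (b := b) (c := c) (d := d)
    (e := e) (f := f) <;>
      with_reducible first | assumption | (rw [dist_comm]; assumption)

theorem not_realizes_patternRing {V : Set E3} :
    ¬ Realizes (fun x y : E3 => dist x y = 1) V PackedGraph.patternRing [] := by
  rintro ⟨x0, -, -, -, x1, -, -, e1, x2, -, -, e2, x3, -, -, e3, x4, -, -, e4, x5, -, -, e5,
    x6, -, -, e6, x7, -, -, e7, x8, -, -, e8, x9, -, -, e9, -⟩
  simp at e1 e2 e3 e4 e5 e6 e7 e8 e9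
  refine not_ring_of_five_tetrahedra ![x0, x2, x4, x6, x8] ![x1, x3, x5, x7, x9] ?_ ?_ <;>
    intro i <;> fin_cases i <;> simp_all [dist_comm]

theorem not_realizes_patternOctahedra {V : Set E3} :
    ¬ Realizes (fun x y : E3 => dist x y = 1) V PackedGraph.patternOctahedra [] := by
  rintro ⟨x12, -, -, -, x13, -, n1, e1, x14, -, n2, e2, x23, -, n3, e3, x24, -, n4, e4, x34, -, n5,
    e5, x15, -, n6, e6, x25, -, n7, e7, x35, -, n8, e8, x45, -, n9, e9, -⟩
  simp at e1 e2 e3 e4 e5 e6 e7 e8 e9 n1 n2 n3 n4 n5 n6 n7 n8 n9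
  -- The octahedra on the pairs from `{1, 2, 3, 4}` and from `{1, 2, 3, 5}`.
  have octahedron : ∀ y z w : E3, x12 ≠ w → x13 ≠ z → y ≠ x23 → dist x12 y = 1 → dist x13 y = 1 →
      dist x12 z = 1 → dist y z = 1 → dist x23 z = 1 → dist x13 w = 1 → dist y w = 1 →
      dist x23 w = 1 → dist z w = 1 → x12 + w = y + x23 ∧ x13 + z = y + x23 := by
    intro y z w hw hz hy h12y h13y h12z hyz h23z h13w hyw h23w hzw
    have h := add_eq_add_of_octahedron hw hz hy e1 h12z (dist_comm x13 w ▸ h13w)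
      (dist_comm z w ▸ hzw) h12y e3.1 (dist_comm y w ▸ hyw) (dist_comm x23 w ▸ h23w) h13y e3.2
      (dist_comm y z ▸ hyz) (dist_comm x23 z ▸ h23z)
    have h' := add_eq_add_of_octahedron hw hy hz h12y e3.1 (dist_comm y w ▸ hyw)
      (dist_comm x23 w ▸ h23w) e1 h12z (dist_comm x13 w ▸ h13w) (dist_comm z w ▸ hzw)
      (dist_comm x13 y ▸ h13y) hyz (dist_comm x13 x23 ▸ e3.2) h23z
    exact ⟨h', h.symm.trans h'⟩
  obtain ⟨k1, k2⟩ := octahedron x14 x24 x34 (Ne.symm n5.1) (Ne.symm n4.2.1) (Ne.symm n3.2.2)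
    e2.1 e2.2 e4.1 e4.2.1 e4.2.2 e5.1 e5.2.1 e5.2.2.1 e5.2.2.2
  obtain ⟨k3, k4⟩ := octahedron x15 x25 x35 (Ne.symm n8.1) (Ne.symm n7.2.1) n6.2.2.2.1
    e6.1 e6.2.1 e7.1 e7.2.2.2 e7.2.1 e8.1 e8.2.2.2.1 e8.2.1 e8.2.2.2.2
  refine not_unit_to_prism (o := x45) e4.2.1 e5.2.1 e5.2.2.2 e6.2.2 (y' := x25) (z' := x35)
    ?_ ?_ ?_ ?_ ?_ ?_ ?_ ?_
  · rw [sub_eq_sub_iff_add_eq_add, ← add_left_inj (x13 + x23)]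
    rw [show x15 + x24 + (x13 + x23) = (x15 + x23) + (x13 + x24) by abel, ← k4, k2]; abel
  · rw [sub_eq_sub_iff_add_eq_add, ← add_left_inj (x12 + x23)]
    rw [show x15 + x34 + (x12 + x23) = (x15 + x23) + (x12 + x34) by abel, ← k3, k1]; abel
  · exact dist_comm x14 x45 ▸ e9.1
  · exact dist_comm x24 x45 ▸ e9.2.1
  · exact dist_comm x34 x45 ▸ e9.2.2.1
  · exact dist_comm x15 x45 ▸ e9.2.2.2.1
  · exact dist_comm x25 x45 ▸ e9.2.2.2.2.1
  · exact dist_comm x35 x45 ▸ e9.2.2.2.2.2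

theorem isBiaugmentedTetrahedron_of_dist {a b x₀ x₁ x₂ x₃ : E3} (h01 : dist x₀ x₁ = 1)
    (h02 : dist x₀ x₂ = 1) (h03 : dist x₀ x₃ = 1) (h12 : dist x₁ x₂ = 1) (h13 : dist x₁ x₃ = 1)
    (h23 : dist x₂ x₃ = 1) (ha1 : dist a x₁ = 1) (ha2 : dist a x₂ = 1) (ha3 : dist a x₃ = 1)
    (ha : a ≠ x₀) (hb0 : dist b x₀ = 1) (hb2 : dist b x₂ = 1) (hb3 : dist b x₃ = 1)
    (hb : b ≠ x₁) : IsBiaugmentedTetrahedron a b ![x₀, x₁, x₂, x₃] where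
  dist_eq i j hij := by
    have key : ∀ i j : Fin 4, i < j → dist (![x₀, x₁, x₂, x₃] i) (![x₀, x₁, x₂, x₃] j) = 1 := by
      simp [Fin.forall_fin_succ, *]
    rcases lt_or_gt_of_ne hij with h | h
    · exact key i j h
    · exact (dist_comm _ _).trans (key j i h)
  dist_left := by simp [Fin.forall_fin_succ, *]
  left_ne := ha
  dist_right := by simp [Fin.forall_fin_succ, *]
  right_ne := hb

theorem isPairOfBiaugmentedTetrahedra_of_realizes {V : Set E3} (hV : V.encard = 10)
    (h : Realizes (fun x y : E3 => dist x y = 1) V PackedGraph.patternBiaugmented []) :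
    IsPairOfBiaugmentedTetrahedra V := by
  classical
  obtain ⟨x2, h0, -, -, x3, h1, n1, e1, x0, h2, n2, e2, x1, h3, n3, e3, a, h4, n4, e4, b, h5, n5,
    e5, y0, h6, n6, e6, y1, h7, n7, e7, y2, h8, n8, e8, y3, h9, n9, e9, -⟩ := h
  simp at e1 e2 e3 e4 e5 e6 e7 e8 e9 n1 n2 n3 n4 n5 n6 n7 n8 n9
  refine ⟨a, b, ![x0, x1, x2, x3], ![y0, y1, y2, y3], ?_, ?_, e6.1, e7.1, ?_⟩
  · clear hV h0 h1 h2 h3 h4 h5 h6 h7 h8 h9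
    casesm* _ ∧ _
    apply isBiaugmentedTetrahedron_of_dist <;>
      with_reducible first | assumption | (rw [dist_comm]; assumption)
  · have ha : a ≠ y0 := fun h => n6.2.2.2.2.1 h.symm
    have hb : b ≠ y1 := fun h => n7.2.2.2.2.2.1 h.symm
    clear hV h0 h1 h2 h3 h4 h5 h6 h7 h8 h9
    casesm* _ ∧ _
    apply isBiaugmentedTetrahedron_of_dist <;> with_reducible assumption
  · have hnd : [y3, y2, y1, y0, b, a, x1, x0, x3, x2].Nodup := by simp [*]
    have hfin : V.Finite := Set.finite_of_encard_eq_coe (k := 10) hV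
    have hsub : {a, b} ∪ Set.range ![x0, x1, x2, x3] ∪ Set.range ![y0, y1, y2, y3] ⊆ V := by
      rintro z ((hz | ⟨i, rfl⟩) | ⟨i, rfl⟩)
      · rcases hz with rfl | rfl <;> assumption
      · revert i; simp [Fin.forall_fin_succ, *]
      · revert i; simp [Fin.forall_fin_succ, *]
    refine ((hfin.subset hsub).eq_of_subset_of_encard_le hsub ?_).symm
    calc V.encard = (([y3, y2, y1, y0, b, a, x1, x0, x3, x2].toFinset : Finset E3) :
          Set E3).encard := by
            rw [Set.encard_coe_eq_coe_finsetCard, List.toFinset_card_of_nodup hnd, hV]; rfl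
      _ ≤ _ := Set.encard_le_encard fun z hz => by
          have hz : z = y3 ∨ z = y2 ∨ z = y1 ∨ z = y0 ∨ z = b ∨ z = a ∨ z = x1 ∨ z = x0 ∨ z = x3 ∨
            z = x2 := by simpa using hz
          simp only [Set.mem_union, Set.mem_range, Fin.exists_fin_succ]
          simp
          grind

/-! ### Almost-equidistant sets -/

theorem AlmostEquidistant.exists_realizes {S : Finset E3} (hS : AlmostEquidistant (S : Set E3))
    {f : ℕ} (hcard : S.card = f + 4) (hf : 6 ≤ f) (hf' : f ≤ 12) {pats : List (List (List ℕ))}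
    (h : PackedGraph.search (PackedGraph.realizesAny (f + 4) pats) f 4 15
      PackedGraph.fourClique = true) :
    ∃ pat ∈ pats, Realizes (fun x y : E3 => dist x y = 1) (S : Set E3) pat [] := by
  refine exists_realizes_of_search (fun x y h => (dist_comm y x).trans h) (by simp)
    (fun x hx y hy z hz => hS x hx y hy z hz) ?_ ?_ hcard hf hf' h
  · intro l hl hp
    match l, hl with
    | [p, q, x, y, z], _ =>
      simp only [List.pairwise_cons, List.forall_mem_cons] at hp
      exact not_five_unit hp.1.1 hp.1.2.1 hp.1.2.2.1 hp.1.2.2.2.1 hp.2.1.1 hp.2.1.2.1 hp.2.1.2.2.1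
        hp.2.2.1.1 hp.2.2.1.2.1 hp.2.2.2.1.1
  · intro a b c x y z hab hac hbc hxy hxz hyz h
    simp only [List.forall_mem_cons] at h
    exact not_three_three_unit hab hac hbc hxy hxz hyz h.1.1 h.2.1.1 h.2.2.1.1 h.1.2.1 h.2.1.2.1
      h.2.2.1.2.1 h.1.2.2 h.2.1.2.2 h.2.2.1.2.2

theorem AlmostEquidistant.isPairOfBiaugmentedTetrahedra {V : Set E3} (hV : AlmostEquidistant V)
    (hcard : V.encard = 10) : IsPairOfBiaugmentedTetrahedra V := by
  obtain ⟨S, rfl⟩ := (Set.finite_of_encard_eq_coe (k := 10) hcard).exists_finset_coe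
  have hS : S.card = 6 + 4 := by
    rw [Set.encard_coe_eq_coe_finsetCard] at hcard
    exact_mod_cast hcard
  obtain ⟨pat, hpat, h⟩ := hV.exists_realizes hS le_rfl (by norm_num) PackedGraph.search_ten
  simp only [PackedGraph.patterns, List.mem_cons, List.not_mem_nil, or_false] at hpat
  rcases hpat with rfl | rfl | rfl | rfl
  · exact absurd h not_realizes_patternChains
  · exact isPairOfBiaugmentedTetrahedra_of_realizes hcard h
  · exact absurd h not_realizes_patternRing
  · exact absurd h not_realizes_patternOctahedra

theorem AlmostEquidistant.encard_le {V : Set E3} (hV : AlmostEquidistant V) : V.encard ≤ 10 := by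
  by_contra! hlt
  obtain ⟨W, hWV, hW⟩ := Set.exists_subset_encard_eq (Order.add_one_le_of_lt hlt)
  have hW : W.encard = (11 : ℕ) := hW
  obtain ⟨S, rfl⟩ := (Set.finite_of_encard_eq_coe hW).exists_finset_coe
  have hS : S.card = 7 + 4 := by
    rw [Set.encard_coe_eq_coe_finsetCard] at hW
    exact_mod_cast hW
  have hAE : AlmostEquidistant (S : Set E3) :=
    fun p hp q hq r hr => hV p (hWV hp) q (hWV hq) r (hWV hr)
  obtain ⟨pat, hpat, h⟩ := hAE.exists_realizes hS (by norm_num) (by norm_num)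
    PackedGraph.search_eleven
  rw [List.mem_singleton.1 hpat] at h
  exact not_realizes_patternChains h

theorem theorem1p2 :
    maxAlmostEquidistant 3 = 10 ∧
    ∃ V₀ : Set (EuclideanSpace ℝ (Fin 3)),
      AlmostEquidistant V₀ ∧ V₀.encard = 10 ∧ IsPairOfBiaugmentedTetrahedra V₀ ∧
      ∀ V : Set (EuclideanSpace ℝ (Fin 3)),
        AlmostEquidistant V → V.encard = 10 → CongruentSets V V₀ := by
  refine ⟨le_antisymm (sSup_le ?_) (le_sSup ⟨_, almostEquidistant_extremal, encard_extremal⟩),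
    _, almostEquidistant_extremal, encard_extremal, isPairOfBiaugmentedTetrahedra_extremal,
    fun V hV hcard => (hV.isPairOfBiaugmentedTetrahedra hcard).congruentSets_extremal⟩
  rintro _ ⟨V, hV, rfl⟩
  exact hV.encard_le
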